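/- Let $r,s\ge 0$, let $M\in\mathbb N^r$, $N\in\mathbb N^s$ (with $0\in\mathbb N$), $B\in\mathbb C^s$, $k\in\mathbb N$, $t\in\mathbb R$, and let $A\in(\tfrac12\mathbb Z)^r$, $A_1\in(\tfrac14\mathbb Z)^r$, $A_2\in\mathbb R^r$. A hypergeometric series ${}_{q+1}F_q(u_0,\dots,u_q;v_1,\dots,v_q;z)=\sum_{n\ge0}\frac{(u_0)_n\cdots(u_q)_n}{(v_1)_n\cdots(v_q)_n}\frac{z^n}{n!}$ is called admissible if no $v_j$ is a nonpositive integer (it is defined), no $u_j$ is a nonpositive integer (it is non-terminating), and its partial sums converge. Put $q=r+s$; vectors are concatenated as parameter lists. (1) If ${}_{q+1}F_q(k,A,B;A+M,B-N;-1)$ is admissible, or if ${}_{q+1}F_q(k,A_1,B;A_1+M,B-N;1)$ is admissible, then the sum of that series is a linear combination, with coefficients in the field $\mathbb Q(B)$ generated by the entries of $B$, of real and imaginary parts of level-4 multiple zeta values, that is, of convergent sums $$\sum_{n_1>\cdots>n_d>0}\frac{\eta_1^{n_1}\cdots\eta_d^{n_d}}{n_1^{s_1}\cdots n_d^{s_d}},\qquad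 d\ge0,\ s_j\in\mathbb Z_{\ge1},\ \eta_j^4=1,\ (s_1,\eta_1)\ne(1,1),$$ taken as limits of the truncations $n_1<X$ as $X\to\infty$ (the value for $d=0$ being $1$). (2) If ${}_{q+1}F_q(t,A_2,B;A_2+M,B-N;1)$ is admissible, then its sum is expressible via polygamma functions in the following sense. Let $K=\mathbb Q(t,A_2,B)$ be the field generated by $t$ and the entries of $A_2$ and $B$, and let $G\subset\mathbb R$ be the additive group generated by $1$, $t$ and the entries of $A_2$. Then the sum is a finite sum of terms $P\cdot\frac{\Gamma(x)\Gamma(y)}{\Gamma(x+y)}$ with $x,y\in G$, none of $x,y,x+y$ a nonpositive integer, where each $P$ is a polynomial with coefficients in $K$ in values $\psi^{(m)}(w)$, $m\ge0$, $w\in G$ not a nonpositive integer; here $\psi=\Gamma'/\Gamma$. (The factor is $1$ for $x=y=1$.) -/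

import Mathlib

open Filter Topology

noncomputable section

/-- The Pochhammer symbol `(a)_n = a (a+1) ⋯ (a+n-1)`. -/
def poch (a : ℂ) (n : ℕ) : ℂ := (ascPochhammer ℂ n).eval a

/-- The `n`-th term of the generalized hypergeometric series with the given lists of upper and
lower parameters, at the argument `z`. -/
def hypTerm (upper lower : List ℂ) (z : ℂ) (n : ℕ) : ℂ :=
  (upper.map fun a => poch a n).prod / (lower.map fun b => poch b n).prod
    * (z ^ n / (n.factorial : ℂ))

/-- No parameter of the list is a nonpositive integer. For the lower parameters this says that all
terms of the hypergeometric series are defined, for the upper ones that it is non-terminating. -/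
def NoNonposInt (l : List ℂ) : Prop := ∀ a ∈ l, ∀ n : ℕ, a ≠ -(n : ℂ)

/-- The hypergeometric series is defined, does not terminate, and converges (as the limit of its
partial sums, so possibly only conditionally) to `S`. -/
structure HypConvergesTo (upper lower : List ℂ) (z S : ℂ) : Prop where
  defined : NoNonposInt lower
  nonterminating : NoNonposInt upper
  tendsto : Tendsto (fun n => ∑ m ∈ Finset.range n, hypTerm upper lower z m) atTop (𝓝 S)

/-- Truncated colored multiple zeta sums: for the word `(s₁, η₁), …, (s_d, η_d)` this is
`∑ η₁ ^ n₁ ⋯ η_d ^ n_d / (n₁ ^ s₁ ⋯ n_d ^ s_d)` over all `X > n₁ > ⋯ > n_d > 0`. -/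
def cmzvTrunc : List (ℕ × ℂ) → ℕ → ℂ
  | [], _ => 1
  | w :: l, X => ∑ n ∈ Finset.Ico 1 X, w.2 ^ n / (n : ℂ) ^ w.1 * cmzvTrunc l n

/-- `z` is a (colored) multiple zeta value of level 4: the value of a convergent sum
`∑ η₁ ^ n₁ ⋯ η_d ^ n_d / (n₁ ^ s₁ ⋯ n_d ^ s_d)` over `n₁ > ⋯ > n_d > 0` with positive integers
`s_j`, fourth roots of unity `η_j` and `(s₁, η₁) ≠ (1, 1)`; the empty word gives the value `1`. -/
def IsLevelFourMZV (z : ℂ) : Prop :=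
  ∃ w : List (ℕ × ℂ), (∀ p ∈ w, 1 ≤ p.1 ∧ p.2 ^ 4 = 1) ∧ w.head? ≠ some (1, 1) ∧
    Tendsto (cmzvTrunc w) atTop (𝓝 z)

/-- `S` is expressible via level 4 multiple zeta values over the field `K`: it is a `K`-linear
combination of real and imaginary parts of such values. -/
def LevelFourExpressible (K : IntermediateField ℚ ℂ) (S : ℂ) : Prop :=
  S ∈ Submodule.span K
    {x : ℂ | ∃ z : ℂ, IsLevelFourMZV z ∧ (x = ((z.re : ℝ) : ℂ) ∨ x = ((z.im : ℝ) : ℂ))}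

/-- The polygamma function `ψ^(m)`, the `m`-th derivative of `ψ = Γ' / Γ`. -/
def polygamma (m : ℕ) (x : ℂ) : ℂ := iteratedDeriv m Complex.digamma x

/-- The elements of the additive group `G` of real numbers that are not poles of `Γ`. -/
def regularArgs (G : AddSubgroup ℝ) : Set ℝ := {x | x ∈ G ∧ ∀ n : ℕ, x ≠ -(n : ℝ)}

/-- The `K`-algebra generated by all polygamma values at arguments in `G`. -/
def polygammaAlgebra (K : IntermediateField ℚ ℂ) (G : AddSubgroup ℝ) : Subalgebra K ℂ :=
  Algebra.adjoin K {y : ℂ | ∃ m : ℕ, ∃ x ∈ regularArgs G, y = polygamma m (x : ℂ)}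

/-- `S` is expressible via polygamma functions, with coefficients in the field `K` and arguments in
the additive group `G`: it is a finite sum of terms `P * (Γ(x) Γ(y) / Γ(x + y))`, where `P` is a
polynomial over `K` in polygamma values and all arguments lie in `G`. The terms without a Beta
factor are those with `x = y = 1`, if `1 ∈ G`. -/
def PolygammaExpressible (K : IntermediateField ℚ ℂ) (G : AddSubgroup ℝ) (S : ℂ) : Prop :=
  S ∈ Submodule.span (polygammaAlgebra K G)
    {v : ℂ | ∃ x ∈ regularArgs G, ∃ y ∈ regularArgs G, x + y ∈ regularArgs G ∧
      v = Complex.Gamma (x : ℂ) * Complex.Gamma (y : ℂ) / Complex.Gamma ((x + y : ℝ) : ℂ)}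

end

/-! The parameter pairs differ by integers. Hence `(A)_n / (A+M)_n` is a constant divided by a
product of factors `n + A + l`, while `(B)_n / (B-N)_n` is a polynomial in `n`. Apart from `(t)_n /
n!` and `z^n`, the term is therefore a rational function of `n` over `K` with poles only at the
points `-(A+l)`, and it splits into partial fractions over `K`.

If the first parameter is a positive integer `k`, then `(k)_n / n!` is a polynomial too, and the
term is `z^n R(n)` with `z = 1` or `z = -1`. Convergence makes the terms tend to zero, so `R` has no
polynomial part. The sums over single poles may diverge, but only like multiples of one fixed
harmonic sum; since the whole series converges, these multiples cancel, and what remains is a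
`K`-combination of regularized pole sums (`mem_of_tendsto_sum`). Integer shifts move each pole
parameter into `(0, 1]` at the cost of an element of `K`. With denominator 4 at `z = 1` the pole
sums are sums over residue classes modulo 4, obtained from depth-one colored sums by Fourier
inversion; with denominator 2 at `z = -1` they come from the colors `-1` and `i`. For real
parameters at `z = 1` they are polygamma values.

If `t` is not an integer, a large integer `m` is split off: `(t)_n / n!` is a polynomial times the
coefficient `(t')_n / n!` of `(1-x)^(-t')`, where `t' = t - m` is very negative. Termwise
integration gives `∑ (t')_n / n! / (n+a) = B(a, 1-t')`, and higher poles give derivatives in `a`,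
which are the Beta value times polynomials in polygamma values (`exists_iteratedDeriv_betaFun`).
Partial sums of the polynomial part have a closed form of size `n^e` with `e ≠ 0` unless they
vanish, so if they converge their limit is zero (`eq_zero_of_tendsto_binomCoeff_mul`). -/

/-! ### Pochhammer symbols and their quotients -/

theorem poch_zero (a : ℂ) : poch a 0 = 1 := by simp [poch]

theorem poch_succ (a : ℂ) (n : ℕ) : poch a (n + 1) = poch a n * (a + n) := by
  simp [poch, ascPochhammer_succ_eval]

theorem poch_add (a : ℂ) (m n : ℕ) : poch a (m + n) = poch a m * poch (a + m) n := by
  induction n with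
  | zero => simp [poch_zero]
  | succ n ih => rw [← add_assoc, poch_succ, poch_succ, ih]; push_cast; ring

theorem poch_eq_prod (a : ℂ) (n : ℕ) : poch a n = ∏ l ∈ Finset.range n, (a + l) := by
  induction n with
  | zero => simp [poch_zero]
  | succ n ih => rw [poch_succ, ih, Finset.prod_range_succ]

theorem poch_ne_zero {a : ℂ} (ha : ∀ n : ℕ, a ≠ -(n : ℂ)) (n : ℕ) : poch a n ≠ 0 := by
  rw [poch_eq_prod, Finset.prod_ne_zero_iff]
  intro l _ h
  exact ha l (eq_neg_of_add_eq_zero_left h)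

theorem poch_one (n : ℕ) : poch 1 n = n.factorial := by
  simp [poch]

theorem ne_neg_natCast_add {a : ℂ} (ha : ∀ n : ℕ, a ≠ -(n : ℂ)) (m n : ℕ) :
    a + m ≠ -(n : ℂ) := fun h => ha (n + m) (by push_cast; linear_combination h)

/-- Splitting `(a)_(m+n)` after `n` or after `m` factors trades a quotient of length `n` for one of
fixed length `m`, which is rational in `n`. -/
theorem poch_div_poch_add {a : ℂ} (ha : ∀ n : ℕ, a ≠ -(n : ℂ)) (m n : ℕ) :
    poch a n / poch (a + m) n = poch a m * ∏ l ∈ Finset.range m, ((n : ℂ) + (a + l))⁻¹ := by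
  have h1 : ∏ l ∈ Finset.range m, ((n : ℂ) + (a + l))⁻¹ = (poch (a + n) m)⁻¹ := by
    rw [poch_eq_prod, ← Finset.prod_inv_distrib]
    exact Finset.prod_congr rfl fun l _ => by ring_nf
  rw [h1, ← div_eq_mul_inv, div_eq_div_iff (poch_ne_zero (ne_neg_natCast_add ha m) n)
    (poch_ne_zero (ne_neg_natCast_add ha n) m), ← poch_add, ← poch_add, add_comm]

theorem poch_div_poch_sub {b : ℂ} {m : ℕ} (hb : ∀ n : ℕ, b - m ≠ -(n : ℂ)) (n : ℕ) :
    poch b n / poch (b - m) n =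
      (poch (b - m) m)⁻¹ * ∏ l ∈ Finset.range m, ((n : ℂ) + (b - m + l)) := by
  have h1 : ∏ l ∈ Finset.range m, ((n : ℂ) + (b - m + l)) = poch (b - m + n) m := by
    rw [poch_eq_prod]
    exact Finset.prod_congr rfl fun l _ => by ring_nf
  have h2 : poch (b - m) m * poch b n = poch (b - m) n * poch (b - m + n) m := by
    conv_lhs => rw [show b = b - m + m by ring, add_sub_cancel_right, ← poch_add]
    rw [add_comm, poch_add]
  have := poch_ne_zero hb n
  have := poch_ne_zero hb m
  rw [h1]
  field_simp
  linear_combination h2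

theorem poch_mem {K : IntermediateField ℚ ℂ} {a : ℂ} (ha : a ∈ K) (n : ℕ) : poch a n ∈ K := by
  rw [poch_eq_prod]
  exact prod_mem fun l _ => add_mem ha (natCast_mem K l)

theorem hypTerm_cons_ofFn {r s : ℕ} (u z : ℂ) (a c : Fin r → ℂ) (b d : Fin s → ℂ) (n : ℕ) :
    hypTerm (u :: (List.ofFn a ++ List.ofFn b)) (List.ofFn c ++ List.ofFn d) z n =
      poch u n / n.factorial * z ^ n *
        ((∏ i, poch (a i) n / poch (c i) n) * ∏ j, poch (b j) n / poch (d j) n) := by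
  simp only [hypTerm, List.map_cons, List.map_append, List.prod_cons, List.prod_append,
    List.map_ofFn, List.prod_ofFn, Function.comp_apply, Finset.prod_div_distrib]
  ring

/-! ### Partial fractions -/

noncomputable section

/-- The sequences `n ↦ P n` for polynomials `P` over `K`. -/
def polySeqs (K : IntermediateField ℚ ℂ) : Submodule K (ℕ → ℂ) :=
  Submodule.span K {f | ∃ j : ℕ, f = fun n : ℕ => (n : ℂ) ^ j}

/-- The `K`-span of the sequences `n ↦ (n + α)⁻¹ ^ p` with `α ∈ T` and `p > 0`. -/
def poleSeqs (K : IntermediateField ℚ ℂ) (T : Set ℂ) : Submodule K (ℕ → ℂ) :=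
  Submodule.span K {f | ∃ α ∈ T, ∃ p : ℕ, f = fun n : ℕ => ((n : ℂ) + α)⁻¹ ^ (p + 1)}

end

section
variable {K : IntermediateField ℚ ℂ} {T : Set ℂ}

theorem const_mul_seq_mem (V : Submodule K (ℕ → ℂ)) {c : ℂ} (hc : c ∈ K) {f : ℕ → ℂ} (hf : f ∈ V) :
    (fun n => c * f n) ∈ V :=
  V.smul_mem (⟨c, hc⟩ : K) hf

theorem pow_mem_polySeqs (j : ℕ) : (fun n : ℕ => (n : ℂ) ^ j) ∈ polySeqs K :=
  Submodule.subset_span ⟨j, rfl⟩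

theorem pole_mem_poleSeqs {α : ℂ} (hα : α ∈ T) (p : ℕ) :
    (fun n : ℕ => ((n : ℂ) + α)⁻¹ ^ (p + 1)) ∈ poleSeqs K T :=
  Submodule.subset_span ⟨α, hα, p, rfl⟩

theorem mul_mem_of_generators (V : Submodule K (ℕ → ℂ)) (g : ℕ → ℂ)
    (h1 : ∀ j : ℕ, (g * fun n : ℕ => (n : ℂ) ^ j) ∈ V)
    (h2 : ∀ α ∈ T, ∀ p : ℕ, (g * fun n : ℕ => ((n : ℂ) + α)⁻¹ ^ (p + 1)) ∈ V) :
    ∀ f ∈ polySeqs K ⊔ poleSeqs K T, g * f ∈ V := by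
  suffices polySeqs K ⊔ poleSeqs K T ≤ V.comap (LinearMap.mulLeft K g) from fun f hf => this hf
  refine sup_le (Submodule.span_le.2 ?_) (Submodule.span_le.2 ?_)
  · rintro _ ⟨j, rfl⟩
    exact h1 j
  · rintro _ ⟨α, hα, p, rfl⟩
    exact h2 α hα p

/-- The sequences multiplication by which preserves the span of polynomials and of poles in `T`. -/
noncomputable def seqMultipliers (K : IntermediateField ℚ ℂ) (T : Set ℂ) : Submonoid (ℕ → ℂ) where
  carrier := {g | ∀ f ∈ polySeqs K ⊔ poleSeqs K T, g * f ∈ polySeqs K ⊔ poleSeqs K T}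
  one_mem' f hf := by simpa using hf
  mul_mem' {a b} ha hb f hf := by rw [mul_assoc]; exact ha _ (hb _ hf)

theorem mem_of_mem_seqMultipliers {g : ℕ → ℂ} (hg : g ∈ seqMultipliers K T) :
    g ∈ polySeqs K ⊔ poleSeqs K T := by
  have h := hg _ (Submodule.mem_sup_left (pow_mem_polySeqs 0))
  convert h using 1
  ext n; simp

theorem const_mem_seqMultipliers {c : ℂ} (hc : c ∈ K) : (fun _ => c) ∈ seqMultipliers K T :=
  fun _ hf => const_mul_seq_mem _ hc hf

/-- One step of division with remainder: `n / (n+α)^(p+1) = 1 / (n+α)^p - α / (n+α)^(p+1)`. -/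
theorem add_const_mem_seqMultipliers (hT : ∀ α ∈ T, α ∈ K ∧ ∀ n : ℕ, α ≠ -(n : ℂ)) {c : ℂ}
    (hc : c ∈ K) : (fun n : ℕ => (n : ℂ) + c) ∈ seqMultipliers K T := by
  have key : ∀ f ∈ polySeqs K ⊔ poleSeqs K T,
      ((fun n : ℕ => (n : ℂ)) * f) ∈ polySeqs K ⊔ poleSeqs K T := by
    refine mul_mem_of_generators _ _ (fun j => ?_) (fun α hα p => ?_)
    · convert Submodule.mem_sup_left (pow_mem_polySeqs (K := K) (j + 1)) using 1
      ext n; simp [pow_succ']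
    · have e : ((fun n : ℕ => (n : ℂ)) * fun n : ℕ => ((n : ℂ) + α)⁻¹ ^ (p + 1)) =
          (fun n : ℕ => ((n : ℂ) + α)⁻¹ ^ p) - fun n : ℕ => α * ((n : ℂ) + α)⁻¹ ^ (p + 1) := by
        ext n
        have : (n : ℂ) + α ≠ 0 := fun h => (hT α hα).2 n (by linear_combination h)
        have := mul_inv_cancel₀ this
        simp only [Pi.mul_apply, Pi.sub_apply]
        linear_combination ((n : ℂ) + α)⁻¹ ^ p * this
      rw [e]
      refine sub_mem ?_ (const_mul_seq_mem _ (hT α hα).1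
        (Submodule.mem_sup_right (pole_mem_poleSeqs hα p)))
      cases p with
      | zero => simpa using Submodule.mem_sup_left (pow_mem_polySeqs (K := K) 0)
      | succ p => exact Submodule.mem_sup_right (pole_mem_poleSeqs hα p)
  intro f hf
  convert add_mem (key f hf) (const_mul_seq_mem _ hc hf) using 1
  ext n; simp [add_mul]

/-- On powers this is division with remainder by `n + α`. On a pole at `β ≠ α` it is repeated use of
`1/((n+α)(n+β)) = (1/(n+α) - 1/(n+β)) / (β-α)`, where `β - α` is invertible in `K`; for `β = α` the
order rises by one. -/
theorem inv_mem_seqMultipliers (hT : ∀ α ∈ T, α ∈ K ∧ ∀ n : ℕ, α ≠ -(n : ℂ)) {α : ℂ}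
    (hα : α ∈ T) : (fun n : ℕ => ((n : ℂ) + α)⁻¹) ∈ seqMultipliers K T := by
  have hne : ∀ β ∈ T, ∀ n : ℕ, (n : ℂ) + β ≠ 0 := fun β hβ n h =>
    (hT β hβ).2 n (by linear_combination h)
  refine mul_mem_of_generators _ _ (fun j => ?_) (fun β hβ p => ?_)
  · induction j with
    | zero =>
      convert Submodule.mem_sup_right (pole_mem_poleSeqs (K := K) hα 0) using 1
      ext n; simp
    | succ j ih =>
      convert sub_mem (Submodule.mem_sup_left (pow_mem_polySeqs (K := K) j))
        (const_mul_seq_mem _ (hT α hα).1 ih) using 1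
      ext n
      have := hne α hα n
      simp only [Pi.mul_apply, Pi.sub_apply]
      field_simp
      ring
  · by_cases hαβ : β = α
    · subst hαβ
      convert Submodule.mem_sup_right (pole_mem_poleSeqs (K := K) hβ (p + 1)) using 1
      ext n; simp [pow_succ']
    have hd : (β - α)⁻¹ ∈ K := inv_mem (sub_mem (hT β hβ).1 (hT α hα).1)
    have hd0 : β - α ≠ 0 := sub_ne_zero.2 hαβ
    have main : ∀ g : ℕ → ℂ, ((fun n : ℕ => ((n : ℂ) + α)⁻¹) * g) ∈ polySeqs K ⊔ poleSeqs K T →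
        ((fun n : ℕ => ((n : ℂ) + β)⁻¹) * g) ∈ polySeqs K ⊔ poleSeqs K T →
        ((fun n : ℕ => ((n : ℂ) + α)⁻¹) * ((fun n : ℕ => ((n : ℂ) + β)⁻¹) * g)) ∈
          polySeqs K ⊔ poleSeqs K T := by
      intro g h1 h2
      convert const_mul_seq_mem _ hd (sub_mem h1 h2) using 1
      ext n
      have := hne α hα n
      have := hne β hβ n
      simp only [Pi.mul_apply, Pi.sub_apply]
      field_simp
      ring
    have e : ∀ p : ℕ, (fun n : ℕ => ((n : ℂ) + β)⁻¹ ^ (p + 1)) =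
        (fun n : ℕ => ((n : ℂ) + β)⁻¹) * fun n : ℕ => ((n : ℂ) + β)⁻¹ ^ p := by
      intro p; ext n; simp [pow_succ']
    induction p with
    | zero =>
      rw [e]
      refine main _ ?_ ?_
      · convert Submodule.mem_sup_right (pole_mem_poleSeqs (K := K) hα 0) using 1
        ext n; simp
      · convert Submodule.mem_sup_right (pole_mem_poleSeqs (K := K) hβ 0) using 1
        ext n; simp
    | succ p ih =>
      rw [e]
      refine main _ ih ?_
      rw [← e]
      exact Submodule.mem_sup_right (pole_mem_poleSeqs (K := K) hβ (p + 1))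

theorem poch_div_add_mem_seqMultipliers (hT : ∀ α ∈ T, α ∈ K ∧ ∀ n : ℕ, α ≠ -(n : ℂ)) {a : ℂ}
    (haK : a ∈ K) (ha : ∀ n : ℕ, a ≠ -(n : ℂ)) {m : ℕ} (haT : ∀ l : ℕ, a + l ∈ T) :
    (fun n => poch a n / poch (a + m) n) ∈ seqMultipliers K T := by
  have e : (fun n => poch a n / poch (a + m) n) = (fun _ => poch a m) *
      ∏ l ∈ Finset.range m, fun n : ℕ => ((n : ℂ) + (a + l))⁻¹ := by
    ext n
    simp [poch_div_poch_add ha]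
  rw [e]
  exact mul_mem (const_mem_seqMultipliers (poch_mem haK m))
    (prod_mem fun l _ => inv_mem_seqMultipliers hT (haT l))

theorem poch_div_sub_mem_seqMultipliers (hT : ∀ α ∈ T, α ∈ K ∧ ∀ n : ℕ, α ≠ -(n : ℂ)) {b : ℂ}
    (hbK : b ∈ K) {m : ℕ} (hb : ∀ n : ℕ, b - m ≠ -(n : ℂ)) :
    (fun n => poch b n / poch (b - m) n) ∈ seqMultipliers K T := by
  have e : (fun n => poch b n / poch (b - m) n) = (fun _ => (poch (b - m) m)⁻¹) *
      ∏ l ∈ Finset.range m, fun n : ℕ => (n : ℂ) + (b - m + l) := by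
    ext n
    simp [poch_div_poch_sub hb]
  have hbm : b - m ∈ K := sub_mem hbK (natCast_mem K m)
  rw [e]
  exact mul_mem (const_mem_seqMultipliers (inv_mem (poch_mem hbm m)))
    (prod_mem fun l _ => add_const_mem_seqMultipliers hT (add_mem hbm (natCast_mem K l)))

theorem prod_poch_div_mem_seqMultipliers (hT : ∀ α ∈ T, α ∈ K ∧ ∀ n : ℕ, α ≠ -(n : ℂ))
    {r s : ℕ} {A : Fin r → ℂ} {B : Fin s → ℂ} {M : Fin r → ℕ} {N : Fin s → ℕ}
    (hAT : ∀ i, ∀ l : ℕ, A i + l ∈ T) (hBK : ∀ j, B j ∈ K)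
    (hBN : ∀ j, ∀ n : ℕ, B j - N j ≠ -(n : ℂ)) :
    (fun n => (∏ i, poch (A i) n / poch (A i + M i) n) * ∏ j, poch (B j) n / poch (B j - N j) n) ∈
      seqMultipliers K T := by
  have e : (fun n => (∏ i, poch (A i) n / poch (A i + M i) n) *
      ∏ j, poch (B j) n / poch (B j - N j) n) =
      (∏ i, fun n => poch (A i) n / poch (A i + M i) n) *
        ∏ j, fun n => poch (B j) n / poch (B j - N j) n := by
    ext n; simp
  have hA : ∀ i, A i ∈ T := fun i => by simpa using hAT i 0
  rw [e]
  exact mul_mem (prod_mem fun i _ => poch_div_add_mem_seqMultipliers hT (hT _ (hA i)).1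
      (hT _ (hA i)).2 (hAT i))
    (prod_mem fun j _ => poch_div_sub_mem_seqMultipliers hT (hBK j) (hBN j))

theorem exists_polynomial_of_mem_polySeqs {f : ℕ → ℂ} (hf : f ∈ polySeqs K) :
    ∃ P : Polynomial ℂ, ∀ n : ℕ, f n = P.eval (n : ℂ) := by
  induction hf using Submodule.span_induction with
  | mem x h => obtain ⟨j, rfl⟩ := h; exact ⟨Polynomial.X ^ j, by simp⟩
  | zero => exact ⟨0, by simp⟩
  | add x y _ _ hx hy =>
    obtain ⟨P, hP⟩ := hx
    obtain ⟨Q, hQ⟩ := hy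
    exact ⟨P + Q, by simp [hP, hQ]⟩
  | smul c x _ hx =>
    obtain ⟨P, hP⟩ := hx
    exact ⟨Polynomial.C (c : ℂ) * P, fun n => by simp [hP, Algebra.smul_def]⟩

theorem tendsto_inv_natCast_add (α : ℂ) :
    Tendsto (fun n : ℕ => ((n : ℂ) + α)⁻¹) atTop (𝓝 0) :=
  tendsto_inv₀_cobounded.comp
    ((tendsto_add_const_cobounded α).comp (tendsto_norm_atTop_iff_cobounded.1
      (by simpa using tendsto_natCast_atTop_atTop (R := ℝ))))

theorem tendsto_zero_of_mem_poleSeqs {f : ℕ → ℂ} (hf : f ∈ poleSeqs K T) :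
    Tendsto f atTop (𝓝 0) := by
  induction hf using Submodule.span_induction with
  | mem x h =>
    obtain ⟨α, _, p, rfl⟩ := h
    simpa using (tendsto_inv_natCast_add α).pow (p + 1)
  | zero => exact tendsto_const_nhds
  | add x y _ _ hx hy => simpa using! hx.add hy
  | smul c x _ hx =>
    simpa using! hx.const_mul (c : ℂ)

theorem polynomial_eq_zero_of_tendsto {P : Polynomial ℂ}
    (h : Tendsto (fun n : ℕ => P.eval (n : ℂ)) atTop (𝓝 0)) : P = 0 := by
  by_cases hd : 0 < P.degree
  · have h1 := P.tendsto_norm_atTop hd (l := atTop) (z := fun n : ℕ => (n : ℂ))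
      (by simpa using tendsto_natCast_atTop_atTop (R := ℝ))
    exact absurd h.norm (not_tendsto_nhds_of_tendsto_atTop h1 _)
  · rw [Polynomial.eq_C_of_degree_le_zero (not_lt.1 hd)] at h ⊢
    simp only [Polynomial.eval_C] at h
    rw [tendsto_nhds_unique tendsto_const_nhds h, map_zero]

/-- A sequence that tends to zero has no polynomial part. -/
theorem mem_poleSeqs_of_tendsto {f : ℕ → ℂ} (hf : f ∈ polySeqs K ⊔ poleSeqs K T)
    (h : Tendsto f atTop (𝓝 0)) : f ∈ poleSeqs K T := by
  obtain ⟨g, hg, k, hk, rfl⟩ := Submodule.mem_sup.1 hf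
  obtain ⟨P, hP⟩ := exists_polynomial_of_mem_polySeqs hg
  have h1 : Tendsto g atTop (𝓝 0) := by
    simpa using h.sub (tendsto_zero_of_mem_poleSeqs hk)
  have h2 : P = 0 := polynomial_eq_zero_of_tendsto (h1.congr hP)
  have h3 : g = 0 := by ext n; simp [hP, h2]
  simpa [h3] using hk

end

/-! ### Regularized limits -/

section
variable {K : IntermediateField ℚ ℂ} {T : Set ℂ} {E : Submodule K ℂ} {L : ℕ → ℂ}

/-- After subtraction of a multiple of `L`, the sequence `F` converges to an element of `E`. -/
def RegTendsto (E : Submodule K ℂ) (L F : ℕ → ℂ) : Prop :=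
  ∃ c : ℂ, ∃ S ∈ E, Tendsto (fun X => F X - c * L X) atTop (𝓝 S)

theorem RegTendsto.add {F G : ℕ → ℂ} (hF : RegTendsto E L F) (hG : RegTendsto E L G) :
    RegTendsto E L (fun X => F X + G X) := by
  obtain ⟨c, S, hS, h⟩ := hF
  obtain ⟨d, U, hU, k⟩ := hG
  exact ⟨c + d, S + U, add_mem hS hU, (h.add k).congr fun X => by ring⟩

theorem RegTendsto.const_mul {F : ℕ → ℂ} (hF : RegTendsto E L F) {a : ℂ} (ha : a ∈ K) :
    RegTendsto E L (fun X => a * F X) := by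
  obtain ⟨c, S, hS, h⟩ := hF
  exact ⟨a * c, a * S, E.smul_mem (⟨a, ha⟩ : K) hS, (h.const_mul a).congr fun X => by ring⟩

theorem RegTendsto.of_tendsto {F : ℕ → ℂ} {S : ℂ} (hS : S ∈ E) (h : Tendsto F atTop (𝓝 S)) :
    RegTendsto E L F :=
  ⟨0, S, hS, by simpa using h⟩

theorem regTendsto_self : RegTendsto E L L := ⟨1, 0, zero_mem _, by simp⟩

/-- Convergence of `F` forces `c * L` to converge, and `L` is unbounded, so `c = 0`. This is why
nothing has to be known about the coefficient `c`. -/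
theorem mem_of_regTendsto {F : ℕ → ℂ} (hL : Tendsto (fun X => ‖L X‖) atTop atTop)
    (hF : RegTendsto E L F) {S : ℂ} (h : Tendsto F atTop (𝓝 S)) : S ∈ E := by
  obtain ⟨c, U, hU, k⟩ := hF
  have hc : c = 0 := by
    by_contra hc
    have h1 : Tendsto (fun X => c * L X) atTop (𝓝 (S - U)) := (h.sub k).congr fun X => by ring
    refine not_tendsto_nhds_of_tendsto_atTop ?_ _ h1.norm
    simpa using hL.const_mul_atTop (norm_pos_iff.2 hc)
  rw [tendsto_nhds_unique h (by simpa [hc] using k)]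
  exact hU

theorem norm_pow_of_sq_eq_one {z : ℂ} (hz : z ^ 2 = 1) (n : ℕ) : ‖z ^ n‖ = 1 := by
  have : z = 1 ∨ z = -1 := sq_eq_one_iff.1 hz
  rcases this with rfl | rfl <;> simp

/-- Convergence is used twice: the terms tend to zero, which removes the polynomial part of `f`, and
the sum has a finite limit, which removes the multiple of `L` left by the poles. -/
theorem mem_of_tendsto_sum {z : ℂ} (hz : z ^ 2 = 1) (hL : Tendsto (fun X => ‖L X‖) atTop atTop)
    (hT : ∀ α ∈ T, ∀ p : ℕ,
      RegTendsto E L fun X => ∑ n ∈ Finset.range X, z ^ n * ((n : ℂ) + α)⁻¹ ^ (p + 1))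
    {f : ℕ → ℂ} (hf : f ∈ polySeqs K ⊔ poleSeqs K T) {S : ℂ}
    (h : Tendsto (fun X => ∑ n ∈ Finset.range X, z ^ n * f n) atTop (𝓝 S)) : S ∈ E := by
  have h0 : Tendsto f atTop (𝓝 0) := by
    have h1 : Tendsto (fun n => z ^ n * f n) atTop (𝓝 0) := by
      simpa [Finset.sum_range_succ] using (h.comp (tendsto_add_atTop_nat 1)).sub h
    rw [tendsto_zero_iff_norm_tendsto_zero] at h1 ⊢
    simpa [-norm_pow, norm_pow_of_sq_eq_one hz] using h1
  refine mem_of_regTendsto hL ?_ h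
  have hf' := mem_poleSeqs_of_tendsto hf h0
  clear h h0 hf
  induction hf' using Submodule.span_induction with
  | mem x h => obtain ⟨α, hα, p, rfl⟩ := h; exact hT α hα p
  | zero => exact ⟨0, 0, zero_mem _, by simp⟩
  | add x y _ _ hx hy => simpa [mul_add, Finset.sum_add_distrib] using! hx.add hy
  | smul c x _ hx =>
    convert hx.const_mul c.2 using 2 with X
    rw [Finset.mul_sum]
    refine Finset.sum_congr rfl fun n _ => ?_
    change z ^ n * (c * x n) = _
    ring

/-- Reindexing changes the sum by a factor `z` and two boundary terms. The one at `X` tends to zero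
and the one at `0` lies in `K`, hence in `E`, because `1 ∈ E`. -/
theorem regTendsto_pole_shift_iff {z : ℂ} (hz : z ^ 2 = 1) (h1 : (1 : ℂ) ∈ E) {α : ℂ} (hα : α ∈ K)
    (p : ℕ) :
    (RegTendsto E L fun X => ∑ n ∈ Finset.range X, z ^ n * ((n : ℂ) + (α + 1))⁻¹ ^ (p + 1)) ↔
      RegTendsto E L fun X => ∑ n ∈ Finset.range X, z ^ n * ((n : ℂ) + α)⁻¹ ^ (p + 1) := by
  have hzK : z ∈ K := by
    rcases sq_eq_one_iff.1 hz with rfl | rfl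
    · exact one_mem K
    · exact neg_mem (one_mem K)
  have hlim : Tendsto (fun X : ℕ => α⁻¹ ^ (p + 1) - z ^ X * ((X : ℂ) + α)⁻¹ ^ (p + 1)) atTop
      (𝓝 (α⁻¹ ^ (p + 1))) := by
    have : Tendsto (fun X : ℕ => z ^ X * ((X : ℂ) + α)⁻¹ ^ (p + 1)) atTop (𝓝 0) := by
      rw [tendsto_zero_iff_norm_tendsto_zero]
      have h2 := ((tendsto_inv_natCast_add α).pow (p + 1)).norm
      simp only [norm_mul, norm_pow_of_sq_eq_one hz, one_mul]
      simpa using h2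
    simpa using tendsto_const_nhds.sub this
  have hmem : α⁻¹ ^ (p + 1) ∈ E := by
    have : α⁻¹ ^ (p + 1) * 1 ∈ E := E.smul_mem (⟨_, pow_mem (inv_mem hα) _⟩ : K) h1
    rwa [mul_one] at this
  have hb : RegTendsto E L (fun X : ℕ => α⁻¹ ^ (p + 1) - z ^ X * ((X : ℂ) + α)⁻¹ ^ (p + 1)) :=
    .of_tendsto hmem hlim
  have key : ∀ X : ℕ, (∑ n ∈ Finset.range X, z ^ n * ((n : ℂ) + α)⁻¹ ^ (p + 1)) =
      z * (∑ n ∈ Finset.range X, z ^ n * ((n : ℂ) + (α + 1))⁻¹ ^ (p + 1)) +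
        (α⁻¹ ^ (p + 1) - z ^ X * ((X : ℂ) + α)⁻¹ ^ (p + 1)) := by
    intro X
    have h2 := Finset.sum_range_succ' (fun n : ℕ => z ^ n * ((n : ℂ) + α)⁻¹ ^ (p + 1)) X
    rw [Finset.sum_range_succ] at h2
    have h3 : z * (∑ n ∈ Finset.range X, z ^ n * ((n : ℂ) + (α + 1))⁻¹ ^ (p + 1)) =
        ∑ n ∈ Finset.range X, z ^ (n + 1) * (((n + 1 : ℕ) : ℂ) + α)⁻¹ ^ (p + 1) := by
      rw [Finset.mul_sum]
      refine Finset.sum_congr rfl fun n _ => ?_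
      push_cast
      rw [show (n : ℂ) + 1 + α = n + (α + 1) by ring]
      ring
    rw [h3]
    simp only [Nat.cast_zero, pow_zero, one_mul, zero_add] at h2
    linear_combination h2
  constructor
  · intro h
    simp only [key]
    exact (h.const_mul hzK).add hb
  · intro h
    -- The factor `z` is its own inverse, so multiplying by it once more solves `key` for the
    -- shifted sum.
    convert (h.add (hb.const_mul (neg_mem (one_mem K)))).const_mul hzK using 2 with X
    rw [key]
    linear_combination -(∑ n ∈ Finset.range X, z ^ n * ((n : ℂ) + (α + 1))⁻¹ ^ (p + 1)) * hz

end

/-! ### Reduction of fractions modulo integers -/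

/-- Steps of size one connect every admissible fraction to one in `(0, 1]`. The path from a negative
fraction upwards never meets `0`, since only nonpositive integers would reach it. -/
theorem int_div_induction {Q : ℂ → Prop} {d : ℕ} (hd : 0 < d)
    (hQ : ∀ j : ℕ, 1 ≤ j → j ≤ d → Q ((j : ℂ) / d))
    (hs : ∀ h : ℤ, h ≠ 0 → (Q ((h : ℂ) / d + 1) ↔ Q ((h : ℂ) / d)))
    (h : ℤ) (hreg : ∀ n : ℕ, (h : ℂ) / d ≠ -(n : ℂ)) : Q ((h : ℂ) / d) := by
  have hd' : (d : ℂ) ≠ 0 := Nat.cast_ne_zero.2 hd.ne'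
  have hstep : ∀ h : ℤ, h ≠ 0 → (Q (((h + d : ℤ) : ℂ) / d) ↔ Q ((h : ℂ) / d)) := by
    intro h hh
    rw [← hs h hh]
    push_cast
    rw [add_div, div_self hd']
  have hup : ∀ m : ℕ, 1 ≤ m → Q (((m : ℤ) : ℂ) / d) := by
    intro m
    induction m using Nat.strong_induction_on with
    | _ m ih =>
      intro hm
      rcases le_or_gt m d with hmd | hmd
      · exact_mod_cast hQ m hm hmd
      · have := (hstep ((m - d : ℕ) : ℤ) (by omega)).2 (ih (m - d) (by omega) (by omega))
        rwa [show ((m - d : ℕ) : ℤ) + d = m by omega] at this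
  have hdown : ∀ m : ℕ, ∀ h : ℤ, 1 ≤ h + m → (∀ n : ℕ, (h : ℂ) / d ≠ -(n : ℂ)) →
      Q ((h : ℂ) / d) := by
    intro m
    induction m using Nat.strong_induction_on with
    | _ m ih =>
      intro h hm hr
      rcases le_or_gt 1 h with h1 | h1
      · lift h to ℕ using by omega
        exact hup h (by omega)
      · have h0 : h ≠ 0 := by rintro rfl; exact hr 0 (by simp)
        rw [← hstep h h0]
        refine ih (m - d) (by omega) _ (by omega) fun n hn => hr (n + 1) ?_
        push_cast at hn ⊢
        rw [add_div, div_self hd'] at hn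
        linear_combination hn
  exact hdown (1 - h).toNat h (by omega) hreg

/-! ### Multiple zeta values of depth one -/

theorem cmzvTrunc_singleton (q : ℕ) (η : ℂ) (X : ℕ) :
    cmzvTrunc [(q, η)] X = ∑ n ∈ Finset.Ico 1 X, η ^ n / (n : ℂ) ^ q := by
  simp [cmzvTrunc]

/-- For `η = 1` the exponent is at least 2 and the series converges absolutely; for `η ≠ 1` the
geometric sums of `η` are bounded by `2 / ‖η - 1‖` and Dirichlet's test applies. -/
theorem exists_tendsto_cmzvTrunc_singleton {q : ℕ} {η : ℂ} (hη : η ^ 4 = 1)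
    (h : (q + 1, η) ≠ (1, 1)) : ∃ z, Tendsto (cmzvTrunc [(q + 1, η)]) atTop (𝓝 z) := by
  have hn : ‖η‖ = 1 := Complex.norm_eq_one_of_pow_eq_one hη (by norm_num)
  suffices hC : CauchySeq fun X => ∑ n ∈ Finset.range X, (1 / ((n : ℝ) + 1) ^ (q + 1)) • η ^ (n + 1) by
    obtain ⟨z, hz⟩ := cauchySeq_tendsto_of_complete hC
    refine ⟨z, (tendsto_add_atTop_iff_nat 1).1 (hz.congr fun X => ?_)⟩
    rw [cmzvTrunc_singleton, Finset.sum_Ico_eq_sum_range]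
    refine Finset.sum_congr rfl fun n _ => ?_
    rw [Complex.real_smul]
    push_cast
    rw [add_comm 1 n, add_comm 1 (n : ℂ)]
    ring
  by_cases h1 : η = 1
  · have hq : 1 < q + 1 := by
      rcases Nat.eq_zero_or_pos q with rfl | hq
      · exact absurd (by rw [h1]) h
      · omega
    have hs : Summable fun n : ℕ => (1 / ((n : ℝ) + 1) ^ (q + 1)) • η ^ (n + 1) := by
      refine Summable.of_norm ?_
      have := (summable_nat_add_iff 1).2 (Real.summable_one_div_nat_pow.2 hq)
      refine this.congr fun n => ?_
      rw [norm_smul, norm_pow, hn, one_pow, mul_one, Real.norm_of_nonneg (by positivity)]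
      push_cast
      rfl
    exact hs.hasSum.tendsto_sum_nat.cauchySeq
  · refine Antitone.cauchySeq_series_mul_of_tendsto_zero_of_bounded (b := 2 / ‖η - 1‖)
      ?_ ?_ fun n => ?_
    · intro a b hab
      dsimp only
      gcongr
    · have := (tendsto_one_div_add_atTop_nhds_zero_nat (𝕜 := ℝ)).pow (q + 1)
      simpa using this
    · have h2 : η - 1 ≠ 0 := sub_ne_zero.2 h1
      simp only [pow_succ, ← Finset.sum_mul]
      rw [geom_sum_eq h1, norm_mul, hn, mul_one, norm_div]
      gcongr
      refine (norm_sub_le _ _).trans ?_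
      simp [hn]; norm_num

section
variable {K : IntermediateField ℚ ℂ}

/-- The `K`-span of the real and imaginary parts of multiple zeta values of level 4. -/
noncomputable def levelFourSpan (K : IntermediateField ℚ ℂ) : Submodule K ℂ :=
  Submodule.span K
    {x : ℂ | ∃ z : ℂ, IsLevelFourMZV z ∧ (x = ((z.re : ℝ) : ℂ) ∨ x = ((z.im : ℝ) : ℂ))}

theorem one_mem_levelFourSpan : (1 : ℂ) ∈ levelFourSpan K :=
  Submodule.subset_span ⟨1, ⟨[], by simp, by simp, tendsto_const_nhds⟩, by simp⟩

theorem exists_tendsto_depth_one {q : ℕ} {η : ℂ} (hη : η ^ 4 = 1) (h : (q + 1, η) ≠ (1, 1)) :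
    ∃ z, Tendsto (cmzvTrunc [(q + 1, η)]) atTop (𝓝 z) ∧ ((z.re : ℝ) : ℂ) ∈ levelFourSpan K ∧
      ((z.im : ℝ) : ℂ) ∈ levelFourSpan K := by
  obtain ⟨z, hz⟩ := exists_tendsto_cmzvTrunc_singleton hη h
  have hM : IsLevelFourMZV z := ⟨[(q + 1, η)], by simp [hη], by simpa using h, hz⟩
  exact ⟨z, hz, Submodule.subset_span ⟨z, hM, .inl rfl⟩, Submodule.subset_span ⟨z, hM, .inr rfl⟩⟩

/-- The harmonic sums `∑ 1 / n` over `1 ≤ n ≤ 4 X`. -/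
noncomputable def harmonicFour (X : ℕ) : ℂ := ((cmzvTrunc [(1, 1)] (4 * X + 1)).re : ℂ)

theorem tendsto_norm_harmonicFour : Tendsto (fun X => ‖harmonicFour X‖) atTop atTop := by
  have h1 := (Real.tendsto_sum_range_one_div_nat_succ_atTop).comp
    (tendsto_id.const_mul_atTop' (r := 4) (by norm_num))
  refine tendsto_atTop_mono (fun X => ?_) h1
  rw [harmonicFour, Complex.norm_real]
  refine le_trans (le_of_eq ?_) (le_abs_self _)
  rw [cmzvTrunc_singleton, Finset.sum_Ico_eq_sum_range, Complex.re_sum]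
  refine Finset.sum_congr rfl fun n _ => ?_
  have : ((1 : ℂ) ^ (1 + n) / (((1 + n : ℕ) : ℂ)) ^ 1) = ((1 / ((n : ℝ) + 1) : ℝ) : ℂ) := by
    push_cast
    simp [add_comm]
  rw [this, Complex.ofReal_re]

theorem regTendsto_re_depth_one (q : ℕ) {η : ℂ} (hη : η ^ 4 = 1) :
    RegTendsto (levelFourSpan K) harmonicFour
      fun X => ((cmzvTrunc [(q + 1, η)] (4 * X + 1)).re : ℂ) := by
  by_cases h : (q + 1, η) = (1, 1)
  · rw [h]
    exact regTendsto_self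
  · obtain ⟨z, hz, hre, -⟩ := exists_tendsto_depth_one (K := K) hη h
    refine .of_tendsto hre ?_
    have h4 : Tendsto (fun X : ℕ => 4 * X + 1) atTop atTop :=
      tendsto_atTop_mono (fun X => by dsimp; omega) tendsto_id
    exact ((Complex.continuous_ofReal.comp Complex.continuous_re).tendsto z).comp (hz.comp h4)

theorem regTendsto_im_I {L : ℕ → ℂ} (q : ℕ) {φ : ℕ → ℕ} (hφ : Tendsto φ atTop atTop) :
    RegTendsto (levelFourSpan K) L
      fun X => ((cmzvTrunc [(q + 1, Complex.I)] (φ X)).im : ℂ) := by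
  have hne : (q + 1, Complex.I) ≠ (1, 1) := fun h => by
    have := congrArg Complex.re (Prod.ext_iff.1 h).2
    simp at this
  obtain ⟨z, hz, -, him⟩ := exists_tendsto_depth_one (K := K) Complex.I_pow_four hne
  exact .of_tendsto him
    (((Complex.continuous_ofReal.comp Complex.continuous_im).tendsto z).comp (hz.comp hφ))

/-- The sums of `1 / n ^ q` over `0 < n < 4 X` with `n` in the residue class of `j` modulo `4`. -/
noncomputable def residueSum (q j X : ℕ) : ℝ :=
  ∑ n ∈ Finset.range X, ((4 * n + j : ℝ) ^ q)⁻¹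

/-- The truncation at `4 * X + 1` contains exactly `X` full periods of `η ^ n`. -/
theorem cmzvTrunc_eq_residueSum (q : ℕ) {η : ℂ} (hη : η ^ 4 = 1) (X : ℕ) :
    cmzvTrunc [(q, η)] (4 * X + 1) = η * residueSum q 1 X + η ^ 2 * residueSum q 2 X +
      η ^ 3 * residueSum q 3 X + residueSum q 4 X := by
  rw [cmzvTrunc_singleton]
  induction X with
  | zero => simp [residueSum]
  | succ X ih =>
    rw [show 4 * (X + 1) + 1 = 4 * X + 1 + 1 + 1 + 1 + 1 by ring]
    iterate 4 rw [Finset.sum_Ico_succ_top (by omega)]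
    rw [ih]
    have h4 : η ^ (4 * X) = 1 := by rw [pow_mul, hη, one_pow]
    simp only [residueSum, Finset.sum_range_succ, pow_succ, h4]
    push_cast
    linear_combination ((4 * (X : ℂ) + 4) ^ q)⁻¹ * hη

/-- Fourier inversion on `ℤ/4`. The real parts at `1`, `-1`, `i` and the imaginary part at `i` are
four independent rational combinations of the residue sums. Since real and imaginary parts are
available separately, the inverse has rational coefficients and `i ∈ K` is not needed. -/
theorem regTendsto_residueSum (q : ℕ) {j : ℕ} (h1 : 1 ≤ j) (h4 : j ≤ 4) :
    RegTendsto (levelFourSpan K) harmonicFour fun X => (residueSum (q + 1) j X : ℂ) := by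
  have hp := regTendsto_re_depth_one (K := K) q (η := 1) (by norm_num)
  have hm := regTendsto_re_depth_one (K := K) q (η := -1) (by norm_num)
  have hi := regTendsto_re_depth_one (K := K) q (η := Complex.I) Complex.I_pow_four
  have hj := regTendsto_im_I (K := K) (L := harmonicFour) q (φ := fun X => 4 * X + 1)
    (tendsto_atTop_mono (fun X => by dsimp; omega) tendsto_id)
  simp only [cmzvTrunc_eq_residueSum (q + 1) (one_pow 4)] at hp
  simp only [cmzvTrunc_eq_residueSum (q + 1) (show (-1 : ℂ) ^ 4 = 1 by norm_num)] at hm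
  simp only [cmzvTrunc_eq_residueSum (q + 1) Complex.I_pow_four] at hi hj
  have hK : ∀ x : ℚ, (x : ℂ) ∈ K := fun x => by simp
  have comb : ∀ a b c d : ℚ, ∀ F : ℕ → ℂ, _ → RegTendsto (levelFourSpan K) harmonicFour F :=
    fun a b c d F h => (funext h : F = _) ▸ (((hp.const_mul (hK a)).add (hm.const_mul (hK b))).add
      ((hi.const_mul (hK c)).add (hj.const_mul (hK d))))
  interval_cases j
  · refine comb (1 / 4) (-1 / 4) 0 (1 / 2) _ fun X => ?_
    simp [pow_succ]
    ring
  · refine comb (1 / 4) (1 / 4) (-1 / 2) 0 _ fun X => ?_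
    simp [pow_succ]
    ring
  · refine comb (1 / 4) (-1 / 4) 0 (-1 / 2) _ fun X => ?_
    simp [pow_succ]
    ring
  · refine comb (1 / 4) (1 / 4) (1 / 2) 0 _ fun X => ?_
    simp [pow_succ]
    ring

theorem regTendsto_quarter_pole {α : ℂ} (hα : ∃ h : ℤ, α = (h : ℂ) / 4)
    (hreg : ∀ n : ℕ, α ≠ -(n : ℂ)) (p : ℕ) :
    RegTendsto (levelFourSpan K) harmonicFour
      fun X => ∑ n ∈ Finset.range X, (1 : ℂ) ^ n * ((n : ℂ) + α)⁻¹ ^ (p + 1) := by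
  obtain ⟨h, rfl⟩ := hα
  refine int_div_induction (d := 4) (Q := fun α => RegTendsto (levelFourSpan K) harmonicFour
      fun X => ∑ n ∈ Finset.range X, (1 : ℂ) ^ n * ((n : ℂ) + α)⁻¹ ^ (p + 1))
    (by norm_num) (fun j h1 h4 => ?_) (fun h _ => ?_) h (by exact_mod_cast hreg)
  · convert (regTendsto_residueSum p h1 h4).const_mul (pow_mem (ofNat_mem K 4) (p + 1)) using 2
      with X
    rw [residueSum]
    push_cast
    rw [Finset.mul_sum]
    refine Finset.sum_congr rfl fun n _ => ?_
    rw [one_pow, one_mul, ← inv_pow, ← mul_pow]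
    congr 1
    rw [show (n : ℂ) + j / 4 = (4 * n + j) / 4 by ring, inv_div, div_eq_mul_inv]
  · exact regTendsto_pole_shift_iff (by norm_num) one_mem_levelFourSpan
      (div_mem (intCast_mem K h) (natCast_mem K 4)) p

theorem sum_alternating_eq_cmzvTrunc (q X : ℕ) :
    ∑ n ∈ Finset.range X, (-1 : ℂ) ^ n * ((n : ℂ) + 1)⁻¹ ^ q =
      -((cmzvTrunc [(q, -1)] (X + 1)).re : ℂ) := by
  rw [cmzvTrunc_singleton]
  induction X with
  | zero => simp
  | succ X ih =>
    rw [Finset.sum_range_succ, Finset.sum_Ico_succ_top (by omega), ih]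
    have : (-1 : ℂ) ^ (X + 1) / (((X + 1 : ℕ) : ℂ)) ^ q =
        (((-1) ^ (X + 1) / ((X : ℝ) + 1) ^ q : ℝ) : ℂ) := by push_cast; rfl
    rw [this, Complex.add_re, Complex.ofReal_re]
    push_cast
    rw [pow_succ, inv_pow]
    ring

theorem sum_alternating_odd_eq_cmzvTrunc (q X : ℕ) :
    ∑ n ∈ Finset.range X, (-1 : ℂ) ^ n * (2 * (n : ℂ) + 1)⁻¹ ^ q =
      ((cmzvTrunc [(q, Complex.I)] (2 * X + 1)).im : ℂ) := by
  rw [cmzvTrunc_singleton]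
  induction X with
  | zero => simp
  | succ X ih =>
    rw [show 2 * (X + 1) + 1 = 2 * X + 1 + 1 + 1 by ring, Finset.sum_range_succ,
      Finset.sum_Ico_succ_top (by omega), Finset.sum_Ico_succ_top (by omega), ih]
    have h1 : Complex.I ^ (2 * X + 1) / (((2 * X + 1 : ℕ) : ℂ)) ^ q =
        (((-1) ^ X / (2 * (X : ℝ) + 1) ^ q : ℝ) : ℂ) * Complex.I := by
      rw [pow_succ, pow_mul, Complex.I_sq]; push_cast; ring
    have h2 : Complex.I ^ (2 * X + 1 + 1) / (((2 * X + 1 + 1 : ℕ) : ℂ)) ^ q =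
        (((-1) ^ (X + 1) / (2 * (X : ℝ) + 1 + 1) ^ q : ℝ) : ℂ) := by
      rw [show 2 * X + 1 + 1 = 2 * (X + 1) by ring, pow_mul, Complex.I_sq]; push_cast; ring_nf
    rw [h1, h2, Complex.add_im, Complex.add_im, Complex.ofReal_im, Complex.im_ofReal_mul,
      Complex.I_im]
    push_cast
    field_simp
    ring

/-- The representatives are `1/2` and `1`: the first gives the alternating sum over odd integers, an
imaginary part at `η = i`, the second the alternating sum over all positive integers, at `η = -1`.
Both converge. -/
theorem regTendsto_half_pole {α : ℂ} (hα : ∃ h : ℤ, α = (h : ℂ) / 2)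
    (hreg : ∀ n : ℕ, α ≠ -(n : ℂ)) (p : ℕ) :
    RegTendsto (levelFourSpan K) harmonicFour
      fun X => ∑ n ∈ Finset.range X, (-1 : ℂ) ^ n * ((n : ℂ) + α)⁻¹ ^ (p + 1) := by
  obtain ⟨h, rfl⟩ := hα
  refine int_div_induction (d := 2) (Q := fun α => RegTendsto (levelFourSpan K) harmonicFour
      fun X => ∑ n ∈ Finset.range X, (-1 : ℂ) ^ n * ((n : ℂ) + α)⁻¹ ^ (p + 1))
    (by norm_num) (fun j h1 h4 => ?_) (fun h _ => ?_) h (by exact_mod_cast hreg)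
  · interval_cases j
    · have hφ : Tendsto (fun X : ℕ => 2 * X + 1) atTop atTop :=
        tendsto_atTop_mono (fun X => by dsimp; omega) tendsto_id
      convert (regTendsto_im_I (K := K) (L := harmonicFour) p hφ).const_mul
        (pow_mem (ofNat_mem K 2) (p + 1)) using 2 with X
      rw [← sum_alternating_odd_eq_cmzvTrunc, Finset.mul_sum]
      refine Finset.sum_congr rfl fun n _ => ?_
      rw [mul_left_comm, ← mul_pow]
      congr 2
      push_cast
      rw [show (n : ℂ) + 1 / 2 = (2 * n + 1) / 2 by ring, inv_div, div_eq_mul_inv]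
    · have hne : (p + 1, (-1 : ℂ)) ≠ (1, 1) := fun h => by
        have := (Prod.ext_iff.1 h).2
        norm_num at this
      obtain ⟨z, hz, hre, -⟩ := exists_tendsto_depth_one (K := K) (by norm_num) hne
      refine .of_tendsto (neg_mem hre) ?_
      have h2 := (((Complex.continuous_ofReal.comp Complex.continuous_re).tendsto z).comp
        (hz.comp (tendsto_add_atTop_nat 1))).neg
      refine h2.congr fun X => ?_
      push_cast
      rw [div_self two_ne_zero, sum_alternating_eq_cmzvTrunc]
      rfl
  · exact regTendsto_pole_shift_iff (by norm_num) one_mem_levelFourSpan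
      (div_mem (intCast_mem K h) (natCast_mem K 2)) p

/-! ### Series whose first parameter is a positive integer -/

/-- Since `n! = (1)_n` and `k - (k-1) = 1`, this quotient has the same shape as `(b)_n / (b-m)_n`.
-/
theorem poch_natCast_div_factorial_mem {T : Set ℂ}
    (hT : ∀ α ∈ T, α ∈ K ∧ ∀ n : ℕ, α ≠ -(n : ℂ)) {k : ℕ} (hk : k ≠ 0) :
    (fun n => poch k n / n.factorial) ∈ seqMultipliers K T := by
  obtain ⟨m, rfl⟩ := Nat.exists_eq_succ_of_ne_zero hk
  have e : ((m.succ : ℕ) : ℂ) - m = 1 := by push_cast; ring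
  have := poch_div_sub_mem_seqMultipliers (K := K) (T := T) hT (natCast_mem K m.succ) (m := m)
    (fun n h => Nat.cast_add_one_ne_zero (R := ℂ) n (by linear_combination h - e))
  simpa [e, poch_one] using this

theorem mem_of_hypConvergesTo {T : Set ℂ} {E : Submodule K ℂ} {L : ℕ → ℂ} {z : ℂ} (hz : z ^ 2 = 1)
    (hL : Tendsto (fun X => ‖L X‖) atTop atTop)
    (hTK : ∀ α ∈ T, α ∈ K ∧ ∀ n : ℕ, α ≠ -(n : ℂ))
    (hT : ∀ α ∈ T, ∀ p : ℕ,
      RegTendsto E L fun X => ∑ n ∈ Finset.range X, z ^ n * ((n : ℂ) + α)⁻¹ ^ (p + 1))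
    {r s k : ℕ} {A : Fin r → ℂ} {B : Fin s → ℂ} {M : Fin r → ℕ} {N : Fin s → ℕ}
    (hAT : ∀ i, ∀ l : ℕ, A i + l ∈ T) (hBK : ∀ j, B j ∈ K) {S : ℂ}
    (h : HypConvergesTo ((k : ℂ) :: (List.ofFn A ++ List.ofFn B))
      (List.ofFn (fun i => A i + (M i : ℂ)) ++ List.ofFn (fun j => B j - (N j : ℂ))) z S) :
    S ∈ E := by
  have hk : k ≠ 0 := by
    rintro rfl
    exact h.nonterminating 0 (by simp) 0 (by simp)
  have hBN : ∀ j, ∀ n : ℕ, B j - N j ≠ -(n : ℂ) := fun j =>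
    h.defined _ (List.mem_append_right _ (List.mem_ofFn.2 ⟨j, rfl⟩))
  refine mem_of_tendsto_sum hz hL hT (mem_of_mem_seqMultipliers (mul_mem
    (poch_natCast_div_factorial_mem hTK hk)
    (prod_poch_div_mem_seqMultipliers (M := M) hTK hAT hBK hBN))) (h.tendsto.congr fun X => ?_)
  refine Finset.sum_congr rfl fun n _ => ?_
  rw [hypTerm_cons_ofFn]
  simp only [Pi.mul_apply]
  ring

theorem ne_neg_natCast_of_hypConvergesTo {u z S : ℂ} {r : ℕ} {A : Fin r → ℂ} {l l' : List ℂ}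
    (h : HypConvergesTo (u :: (List.ofFn A ++ l)) l' z S) (i : Fin r) (n : ℕ) :
    A i ≠ -(n : ℂ) :=
  h.nonterminating _ (List.mem_cons_of_mem _ (List.mem_append_left _ (List.mem_ofFn.2 ⟨i, rfl⟩))) n

theorem levelFourExpressible_of_hypConvergesTo {z : ℂ} (hz : z ^ 2 = 1) {d : ℕ} (hd : d ≠ 0)
    (hpole : ∀ α : ℂ, (∃ h : ℤ, α = (h : ℂ) / d) → (∀ n : ℕ, α ≠ -(n : ℂ)) → ∀ p : ℕ,
      RegTendsto (levelFourSpan K) harmonicFour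
        fun X => ∑ n ∈ Finset.range X, z ^ n * ((n : ℂ) + α)⁻¹ ^ (p + 1))
    {r s k : ℕ} {A : Fin r → ℂ} {B : Fin s → ℂ} {M : Fin r → ℕ} {N : Fin s → ℕ}
    (hA : ∀ i, ∃ h : ℤ, A i = (h : ℂ) / d) (hBK : ∀ j, B j ∈ K) {S : ℂ}
    (h : HypConvergesTo ((k : ℂ) :: (List.ofFn A ++ List.ofFn B))
      (List.ofFn (fun i => A i + (M i : ℂ)) ++ List.ofFn (fun j => B j - (N j : ℂ))) z S) :
    LevelFourExpressible K S := by
  refine mem_of_hypConvergesTo (T := {α | (∃ h : ℤ, α = (h : ℂ) / d) ∧ ∀ n : ℕ, α ≠ -(n : ℂ)})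
    hz tendsto_norm_harmonicFour ?_ (fun α hα p => hpole α hα.1 hα.2 p) (fun i l => ⟨?_, ?_⟩) hBK h
  · rintro α ⟨⟨p, rfl⟩, h2⟩
    exact ⟨div_mem (intCast_mem K p) (natCast_mem K d), h2⟩
  · obtain ⟨p, hp⟩ := hA i
    refine ⟨p + l * d, ?_⟩
    rw [hp]
    push_cast
    field_simp
  · exact ne_neg_natCast_add (ne_neg_natCast_of_hypConvergesTo h i) l

end

/-! ### The complement of the poles of the Gamma function -/

/-- The complex numbers that are not poles of the Gamma function. -/
def gammaDomain : Set ℂ := {a | ∀ n : ℕ, a ≠ -(n : ℂ)}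

theorem natCast_add_ne_zero {a : ℂ} (ha : a ∈ gammaDomain) (n : ℕ) : (n : ℂ) + a ≠ 0 :=
  fun h => ha n (by linear_combination h)

theorem mem_gammaDomain_of_re_pos {a : ℂ} (ha : 0 < a.re) : a ∈ gammaDomain := by
  rintro n rfl
  have : (0 : ℝ) ≤ n := n.cast_nonneg
  simp at ha
  linarith

theorem one_mem_gammaDomain : (1 : ℂ) ∈ gammaDomain := mem_gammaDomain_of_re_pos (by simp)

/-- The ratio `(n+1)/(n+a)` tends to 1, hence is bounded. The estimate is uniform near `a`, as
termwise differentiation of series in `1/(n+y)` requires. -/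
theorem exists_norm_natCast_add_ge {a : ℂ} (ha : a ∈ gammaDomain) :
    ∃ δ > 0, ∃ C > 0, ∀ y ∈ Metric.ball a δ, ∀ n : ℕ, C * ((n : ℝ) + 1) ≤ ‖(n : ℂ) + y‖ := by
  have h1 : Tendsto (fun n : ℕ => ‖((n : ℂ) + 1) * ((n : ℂ) + a)⁻¹‖) atTop (𝓝 1) := by
    have h2 := ((tendsto_inv_natCast_add a).const_mul (1 - a)).const_add 1
    have h3 := h2.norm
    simp only [mul_zero, add_zero, norm_one] at h3
    refine h3.congr fun n => ?_
    have := natCast_add_ne_zero ha n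
    congr 1
    field_simp
    ring
  obtain ⟨M, hM⟩ := h1.bddAbove_range
  have hM' : ∀ n : ℕ, (n : ℝ) + 1 ≤ (M + 1) * ‖(n : ℂ) + a‖ := by
    intro n
    have h2 : ‖((n : ℂ) + 1) * ((n : ℂ) + a)⁻¹‖ ≤ M := hM ⟨n, rfl⟩
    have h3 := norm_pos_iff.2 (natCast_add_ne_zero ha n)
    have h4 : ‖(n : ℂ) + 1‖ = (n : ℝ) + 1 := by
      exact_mod_cast Complex.norm_natCast (n + 1)
    rw [norm_mul, norm_inv, ← div_eq_mul_inv, div_le_iff₀ h3, h4] at h2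
    linarith
  have hM0 : 0 < M + 1 := by
    have : (0 : ℝ) ≤ M := (norm_nonneg _).trans (hM ⟨0, rfl⟩)
    linarith
  -- From `(n+1)/(M+1) ≤ ‖n+a‖`, moving `a` by less than `1/(2(M+1))` loses at most half of the
  -- bound.
  refine ⟨1 / (2 * (M + 1)), by positivity, 1 / (2 * (M + 1)), by positivity, fun y hy n => ?_⟩
  have h5 : ‖(n : ℂ) + a‖ - ‖a - y‖ ≤ ‖(n : ℂ) + y‖ := by
    have := norm_sub_norm_le ((n : ℂ) + a) (a - y)
    rwa [show (n : ℂ) + a - (a - y) = n + y by ring] at this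
  have h6 : ‖a - y‖ < 1 / (2 * (M + 1)) := by rwa [← dist_eq_norm, dist_comm]
  have h7 : ((n : ℝ) + 1) / (M + 1) ≤ ‖(n : ℂ) + a‖ := by
    rw [div_le_iff₀ hM0]; linarith [hM' n]
  have h8 : ((n : ℝ) + 1) / (M + 1) = 1 / (2 * (M + 1)) * ((n : ℝ) + 1) +
      1 / (2 * (M + 1)) * ((n : ℝ) + 1) := by field_simp; ring
  have h9 : 1 / (2 * (M + 1)) ≤ 1 / (2 * (M + 1)) * ((n : ℝ) + 1) :=
    le_mul_of_one_le_right (by positivity) (by linarith [n.cast_nonneg (α := ℝ)])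
  linarith

theorem isOpen_gammaDomain : IsOpen gammaDomain := by
  refine Metric.isOpen_iff.2 fun a ha => ?_
  obtain ⟨δ, hδ, C, hC, h⟩ := exists_norm_natCast_add_ge ha
  refine ⟨δ, hδ, fun y hy n hn => ?_⟩
  have h1 := h y hy n
  rw [hn, add_neg_cancel, norm_zero] at h1
  have : 0 < C * ((n : ℝ) + 1) := by positivity
  linarith

theorem isPreconnected_gammaDomain : IsPreconnected gammaDomain := by
  have : gammaDomain = (Set.range fun n : ℕ => -(n : ℂ))ᶜ := by
    ext a
    simp [gammaDomain, eq_comm]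
  rw [this]
  exact ((Set.countable_range _).isConnected_compl_of_one_lt_rank (by simp)).isPreconnected

/-- Identity theorem: the domain is the complement of a countable set, hence connected, and the
positive reals accumulate at 1. It carries formulas proved by real methods to negative arguments. -/
theorem eqOn_gammaDomain_of_eqOn_pos {f g : ℂ → ℂ} (hf : DifferentiableOn ℂ f gammaDomain)
    (hg : DifferentiableOn ℂ g gammaDomain) (h : ∀ x : ℝ, 0 < x → f x = g x) :
    Set.EqOn f g gammaDomain := by
  refine (hf.analyticOnNhd isOpen_gammaDomain).eqOn_of_preconnected_of_frequently_eq
    (hg.analyticOnNhd isOpen_gammaDomain) isPreconnected_gammaDomain one_mem_gammaDomain ?_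
  have hc : Tendsto (fun x : ℝ => (x : ℂ)) (𝓝[>] 1) (𝓝[≠] 1) := by
    refine tendsto_nhdsWithin_iff.2 ⟨?_, ?_⟩
    · exact (Complex.continuous_ofReal.tendsto' 1 1 (by simp)).mono_left nhdsWithin_le_nhds
    · filter_upwards [self_mem_nhdsWithin] with x hx
      simpa using (ne_of_gt hx : x ≠ 1)
  refine hc.frequently (Eventually.frequently ?_)
  filter_upwards [self_mem_nhdsWithin] with x hx
  exact h x (one_pos.trans hx)

/-! ### Series of simple poles at the nonpositive integers -/

section
variable {u : ℕ → ℂ}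

theorem summable_mul_inv_pow (p : ℕ) (hu : Summable fun n => ‖u n‖ / ((n : ℝ) + 1) ^ (p + 1))
    {a : ℂ} (ha : a ∈ gammaDomain) : Summable fun n : ℕ => u n * ((n : ℂ) + a)⁻¹ ^ (p + 1) := by
  obtain ⟨δ, hδ, C, hC, h⟩ := exists_norm_natCast_add_ge ha
  refine Summable.of_norm_bounded (hu.mul_left (C⁻¹ ^ (p + 1))) fun n => ?_
  have h1 := h a (Metric.mem_ball_self hδ) n
  have : 0 < C * ((n : ℝ) + 1) := by positivity
  rw [norm_mul, norm_pow, norm_inv, mul_comm (C⁻¹ ^ (p + 1)), div_mul_eq_mul_div, mul_div_assoc,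
    inv_pow, inv_pow, div_eq_mul_inv, ← mul_inv, ← mul_pow]
  gcongr

theorem hasDerivAt_tsum_mul_inv_pow (p : ℕ)
    (hu : Summable fun n => ‖u n‖ / ((n : ℝ) + 1) ^ (p + 2)) {c : ℕ → ℂ} {a : ℂ}
    (ha : a ∈ gammaDomain) (hs : Summable fun n : ℕ => u n * ((n : ℂ) + a)⁻¹ ^ (p + 1) - c n) :
    HasDerivAt (fun z => ∑' n : ℕ, (u n * ((n : ℂ) + z)⁻¹ ^ (p + 1) - c n))
      (-(p + 1) * ∑' n : ℕ, u n * ((n : ℂ) + a)⁻¹ ^ (p + 2)) a := by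
  obtain ⟨δ, hδ, C, hC, h⟩ := exists_norm_natCast_add_ge ha
  rw [← tsum_mul_left]
  refine hasDerivAt_tsum_of_isPreconnected (t := Metric.ball a δ) (y₀ := a)
    (g' := fun n y => -(p + 1) * (u n * ((n : ℂ) + y)⁻¹ ^ (p + 2)))
    (hu.mul_left ((p + 1) * C⁻¹ ^ (p + 2))) Metric.isOpen_ball
    (convex_ball a δ).isPreconnected (fun n y hy => ?_) (fun n y hy => ?_)
    (Metric.mem_ball_self hδ) hs (Metric.mem_ball_self hδ)
  · have h0 : (n : ℂ) + y ≠ 0 := norm_pos_iff.1 (lt_of_lt_of_le (by positivity) (h y hy n))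
    have h1 := (((((hasDerivAt_id y).const_add (n : ℂ)).inv h0).pow (p + 1)).const_mul
      (u n)).sub_const (c n)
    refine h1.congr_deriv ?_
    simp only [Pi.inv_apply, id, Nat.add_sub_cancel]
    rw [div_eq_mul_inv, ← inv_pow]
    push_cast
    ring
  · have h1 := h y hy n
    have : 0 < C * ((n : ℝ) + 1) := by positivity
    have e : ‖(-((p : ℂ) + 1))‖ = (p : ℝ) + 1 := by
      rw [norm_neg]; exact_mod_cast Complex.norm_natCast (p + 1)
    rw [norm_mul, norm_mul, e, norm_pow, norm_inv, mul_assoc, mul_comm (C⁻¹ ^ (p + 2)),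
      div_mul_eq_mul_div, mul_div_assoc, inv_pow, inv_pow, div_eq_mul_inv _ (((n : ℝ) + 1) ^ _),
      ← mul_inv, ← mul_pow]
    gcongr

/-- The series with simple poles at the nonpositive integers with residues `u n`, normalized to
vanish at `1`. -/
noncomputable def poleSeries (u : ℕ → ℂ) (a : ℂ) : ℂ :=
  ∑' n : ℕ, (u n * ((n : ℂ) + a)⁻¹ ^ (0 + 1) - u n * ((n : ℂ) + 1)⁻¹)

theorem summable_poleSeries (hu : Summable fun n => ‖u n‖ / ((n : ℝ) + 1) ^ 2) {a : ℂ}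
    (ha : a ∈ gammaDomain) :
    Summable fun n : ℕ => u n * ((n : ℂ) + a)⁻¹ ^ (0 + 1) - u n * ((n : ℂ) + 1)⁻¹ := by
  have h1 : Summable fun n => ‖u n * ((n : ℂ) + 1)⁻¹‖ / ((n : ℝ) + 1) ^ (0 + 1) := by
    refine hu.congr fun n => ?_
    have h4 : ‖(n : ℂ) + 1‖ = (n : ℝ) + 1 := by exact_mod_cast Complex.norm_natCast (n + 1)
    rw [norm_mul, norm_inv, h4, zero_add, pow_one]
    field_simp
  refine ((summable_mul_inv_pow 0 h1 ha).mul_left (1 - a)).congr fun n => ?_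
  have := natCast_add_ne_zero ha n
  have : (n : ℂ) + 1 ≠ 0 := Nat.cast_add_one_ne_zero n
  rw [zero_add, pow_one]
  field_simp
  ring

theorem summable_norm_div_pow_mono {p q : ℕ} (hpq : p ≤ q)
    (hu : Summable fun n => ‖u n‖ / ((n : ℝ) + 1) ^ p) :
    Summable fun n => ‖u n‖ / ((n : ℝ) + 1) ^ q := by
  refine hu.of_nonneg_of_le (fun n => by positivity) fun n => ?_
  gcongr
  linarith [n.cast_nonneg (α := ℝ)]

theorem differentiableOn_poleSeries (hu : Summable fun n => ‖u n‖ / ((n : ℝ) + 1) ^ 2) :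
    DifferentiableOn ℂ (poleSeries u) gammaDomain := fun _ ha =>
  (hasDerivAt_tsum_mul_inv_pow 0 hu ha
    (summable_poleSeries hu ha)).differentiableAt.differentiableWithinAt

/-- Used both for digamma, with all `u n = -1`, and for the Beta function, with `u` the binomial
coefficients. The additive constant disappears after one derivative. -/
theorem iteratedDeriv_of_eqOn_poleSeries (hu : Summable fun n => ‖u n‖ / ((n : ℝ) + 1) ^ 2)
    {f : ℂ → ℂ} {C : ℂ} (hf : ∀ a ∈ gammaDomain, f a = poleSeries u a + C) (m : ℕ) {a : ℂ}
    (ha : a ∈ gammaDomain) : iteratedDeriv (m + 1) f a =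
      (-1) ^ (m + 1) * (m + 1).factorial * ∑' n : ℕ, u n * ((n : ℂ) + a)⁻¹ ^ (m + 2) := by
  induction m generalizing a with
  | zero =>
    have h1 := (hasDerivAt_tsum_mul_inv_pow 0 hu ha (summable_poleSeries hu ha)).add_const C
    have h2 : f =ᶠ[𝓝 a] fun z => poleSeries u z + C := by
      filter_upwards [isOpen_gammaDomain.mem_nhds ha] with z hz using hf z hz
    rw [zero_add, iteratedDeriv_one, (h1.congr_of_eventuallyEq h2).deriv]
    simp
  | succ m ih =>
    have hm : Summable fun n => ‖u n‖ / ((n : ℝ) + 1) ^ (m + 1 + 1) :=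
      summable_norm_div_pow_mono (by omega) hu
    have h1 := (hasDerivAt_tsum_mul_inv_pow (u := u) (c := 0) (m + 1)
      (summable_norm_div_pow_mono (by omega) hu) ha
      (by simpa using summable_mul_inv_pow (m + 1) hm ha)).const_mul
        ((-1) ^ (m + 1) * ((m + 1).factorial : ℂ))
    have h2 : iteratedDeriv (m + 1) f =ᶠ[𝓝 a] fun z => (-1) ^ (m + 1) * ((m + 1).factorial : ℂ) *
        ∑' n : ℕ, (u n * ((n : ℂ) + z)⁻¹ ^ (m + 1 + 1) - (0 : ℕ → ℂ) n) := by
      filter_upwards [isOpen_gammaDomain.mem_nhds ha] with z hz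
      simpa using ih hz
    rw [iteratedDeriv_succ, (h1.congr_of_eventuallyEq h2).deriv, Nat.factorial_succ (m + 1)]
    push_cast
    ring

end

/-! ### The digamma function -/

theorem differentiableOn_Gamma : DifferentiableOn ℂ Complex.Gamma gammaDomain := fun a ha =>
  (Complex.differentiableAt_Gamma a ha).differentiableWithinAt

theorem differentiableOn_digamma : DifferentiableOn ℂ Complex.digamma gammaDomain := by
  intro a ha
  exact ((((differentiableOn_Gamma.analyticOnNhd isOpen_gammaDomain).deriv a ha).differentiableAt).div
    (Complex.differentiableAt_Gamma a ha) (Complex.Gamma_ne_zero ha)).differentiableWithinAt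

theorem digamma_ofReal {x : ℝ} (hx : 0 < x) :
    Complex.digamma x = (deriv (Real.log ∘ Real.Gamma) x : ℝ) := by
  have hR : ∀ m : ℕ, x ≠ -m := fun m h => by linarith [m.cast_nonneg (α := ℝ)]
  have hD : (x : ℂ) ∈ gammaDomain := mem_gammaDomain_of_re_pos (by simpa using hx)
  have h1 := (Complex.differentiableAt_Gamma x hD).hasDerivAt.comp_ofReal
  have h2 := (Real.differentiableAt_Gamma hR).hasDerivAt.ofReal_comp
  simp only [Complex.Gamma_ofReal] at h1
  have h3 := h1.unique h2
  rw [Complex.digamma_def, logDeriv_apply, h3, Complex.Gamma_ofReal]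
  have h4 := ((Real.differentiableAt_Gamma hR).hasDerivAt.log (Real.Gamma_ne_zero hR)).deriv
  rw [Function.comp_def, h4]
  push_cast
  rfl

theorem digamma_add_natCast {a : ℂ} (ha : a ∈ gammaDomain) (N : ℕ) :
    Complex.digamma (a + N) = Complex.digamma a + ∑ n ∈ Finset.range N, ((n : ℂ) + a)⁻¹ := by
  induction N with
  | zero => simp
  | succ N ih =>
    rw [Finset.sum_range_succ, ← add_assoc (Complex.digamma a), ← ih]
    push_cast
    rw [← add_assoc, Complex.digamma_apply_add_one _ (ne_neg_natCast_add ha N), add_comm a]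

/-- Log-convexity of `Γ` makes digamma increasing on the positive reals. Both values lie between
those at `N` and `N + m`, which differ by `m` terms of size at most `1/N`. -/
theorem norm_digamma_sub_le {x : ℝ} (hx : 0 < x) {m : ℕ} (hm : 1 ≤ m) (hxm : x ≤ m) {N : ℕ}
    (hN : 1 ≤ N) : ‖Complex.digamma (x + N) - Complex.digamma (1 + N)‖ ≤ m / N := by
  set φ := deriv (Real.log ∘ Real.Gamma) with hφ
  have hmono : MonotoneOn φ (Set.Ioi 0) := by
    refine Real.convexOn_log_Gamma.monotoneOn_deriv fun y hy => ?_
    have hR : ∀ m : ℕ, y ≠ -m := fun m h => by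
      have : 0 < y := hy
      linarith [m.cast_nonneg (α := ℝ)]
    exact (Real.differentiableAt_Gamma hR).log (Real.Gamma_ne_zero hR)
  have hN0 : (1 : ℝ) ≤ N := by exact_mod_cast hN
  have hm0 : (1 : ℝ) ≤ m := by exact_mod_cast hm
  have hdiff : φ (N + m) - φ N ≤ m / N := by
    have h1 := digamma_add_natCast (a := ((N : ℝ) : ℂ))
      (mem_gammaDomain_of_re_pos (by simp; linarith)) m
    have h2 : ((N : ℝ) : ℂ) + m = ((N + m : ℝ) : ℂ) := by push_cast; ring
    rw [h2, digamma_ofReal (by linarith), digamma_ofReal (by linarith)] at h1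
    have h3 : φ (N + m) = φ N + ∑ n ∈ Finset.range m, ((n : ℝ) + N)⁻¹ := by exact_mod_cast h1
    rw [h3, add_sub_cancel_left]
    calc ∑ n ∈ Finset.range m, ((n : ℝ) + N)⁻¹ ≤ ∑ n ∈ Finset.range m, (N : ℝ)⁻¹ := by
          refine Finset.sum_le_sum fun n _ => ?_
          gcongr
          linarith [n.cast_nonneg (α := ℝ)]
      _ = m / N := by simp [div_eq_mul_inv]
  have e1 : (x : ℂ) + N = ((x + N : ℝ) : ℂ) := by push_cast; ring
  have e2 : (1 : ℂ) + N = ((1 + N : ℝ) : ℂ) := by push_cast; ring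
  rw [e1, e2, digamma_ofReal (by linarith), digamma_ofReal (by linarith), ← Complex.ofReal_sub,
    Complex.norm_real, Real.norm_eq_abs, abs_le]
  have pos : ∀ y : ℝ, (N : ℝ) ≤ y → y ∈ Set.Ioi (0 : ℝ) := fun y hy =>
    Set.mem_Ioi.2 (by linarith)
  have a1 := hmono (pos N le_rfl) (pos (x + N) (by linarith)) (by linarith)
  have a2 := hmono (pos (x + N) (by linarith)) (pos (N + m) (by linarith)) (by linarith)
  have a3 := hmono (pos N le_rfl) (pos (1 + N) (by linarith)) (by linarith)
  have a4 := hmono (pos (1 + N) (by linarith)) (pos (N + m) (by linarith)) (by linarith)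
  constructor <;> linarith

theorem tendsto_sum_inv_sub_of_pos {x : ℝ} (hx : 0 < x) :
    Tendsto (fun N => ∑ n ∈ Finset.range N, (((n : ℂ) + x)⁻¹ - ((n : ℂ) + 1)⁻¹)) atTop
      (𝓝 (Complex.digamma 1 - Complex.digamma x)) := by
  have hD : (x : ℂ) ∈ gammaDomain := mem_gammaDomain_of_re_pos (by simpa using hx)
  obtain ⟨m, hm⟩ := exists_nat_ge x
  have h1 : Tendsto (fun N : ℕ => Complex.digamma (x + N) - Complex.digamma (1 + N)) atTop
      (𝓝 0) := by
    refine squeeze_zero_norm' ?_ (tendsto_const_div_atTop_nhds_zero_nat ((m + 1 : ℕ) : ℝ))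
    filter_upwards [eventually_ge_atTop 1] with N hN
    exact norm_digamma_sub_le hx (by omega) (by push_cast; linarith) hN
  have h2 := h1.add_const (Complex.digamma 1 - Complex.digamma x)
  rw [zero_add] at h2
  refine h2.congr fun N => ?_
  rw [digamma_add_natCast hD, digamma_add_natCast one_mem_gammaDomain, Finset.sum_sub_distrib]
  ring

theorem summable_one_div_succ_sq :
    Summable fun n : ℕ => ‖(-1 : ℂ)‖ / ((n : ℝ) + 1) ^ 2 := by
  have := (summable_nat_add_iff 1).2 (Real.summable_one_div_nat_pow.2 one_lt_two)
  refine this.congr fun n => ?_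
  push_cast
  simp

theorem digamma_eq_poleSeries {a : ℂ} (ha : a ∈ gammaDomain) :
    Complex.digamma a = poleSeries (fun _ => -1) a + Complex.digamma 1 := by
  refine eqOn_gammaDomain_of_eqOn_pos (g := fun a => poleSeries (fun _ => -1) a + Complex.digamma 1)
    differentiableOn_digamma
    ((differentiableOn_poleSeries summable_one_div_succ_sq).add_const _) (fun x hx => ?_) ha
  have hD : (x : ℂ) ∈ gammaDomain := mem_gammaDomain_of_re_pos (by simpa using hx)
  have h1 := (summable_poleSeries summable_one_div_succ_sq hD).hasSum.tendsto_sum_nat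
  have h2 := (tendsto_sum_inv_sub_of_pos hx).neg
  have h3 := tendsto_nhds_unique h1 (h2.congr fun N => by
    rw [← Finset.sum_neg_distrib]
    exact Finset.sum_congr rfl fun n _ => by ring)
  rw [poleSeries, h3]
  ring

theorem polygamma_succ_eq {a : ℂ} (ha : a ∈ gammaDomain) (m : ℕ) :
    polygamma (m + 1) a =
      (-1) ^ m * (m + 1).factorial * ∑' n : ℕ, ((n : ℂ) + a)⁻¹ ^ (m + 2) := by
  rw [polygamma, iteratedDeriv_of_eqOn_poleSeries summable_one_div_succ_sq
    (fun a ha => digamma_eq_poleSeries ha) m ha, tsum_mul_left]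
  ring

theorem polygamma_zero : polygamma 0 = Complex.digamma := by
  ext; simp [polygamma]

theorem hasDerivAt_polygamma {a : ℂ} (ha : a ∈ gammaDomain) (m : ℕ) :
    HasDerivAt (polygamma m) (polygamma (m + 1) a) a := by
  have h1 : AnalyticAt ℂ (polygamma m) a := by
    have := (differentiableOn_digamma.analyticOnNhd isOpen_gammaDomain).iterated_deriv m a ha
    rwa [← iteratedDeriv_eq_iterate] at this
  have h2 : polygamma (m + 1) a = deriv (polygamma m) a := by
    rw [polygamma, iteratedDeriv_succ]
    rfl
  rw [h2]
  exact h1.differentiableAt.hasDerivAt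

theorem tendsto_sum_inv_sub {a : ℂ} (ha : a ∈ gammaDomain) :
    Tendsto (fun N => ∑ n ∈ Finset.range N, (((n : ℂ) + a)⁻¹ - ((n : ℂ) + 1)⁻¹)) atTop
      (𝓝 (polygamma 0 1 - polygamma 0 a)) := by
  have h1 := (summable_poleSeries summable_one_div_succ_sq ha).hasSum.tendsto_sum_nat.neg
  have h2 : polygamma 0 1 - polygamma 0 a = -poleSeries (fun _ => -1) a := by
    rw [polygamma_zero, digamma_eq_poleSeries ha]
    ring
  rw [h2]
  refine h1.congr fun N => ?_
  rw [← Finset.sum_neg_distrib]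
  exact Finset.sum_congr rfl fun n _ => by ring

/-! ### The binomial series with exponent `-t` at the point `1` -/

/-- The coefficients of the power series of `(1 - x) ^ (-t)`. -/
noncomputable def binomCoeff (t : ℂ) (n : ℕ) : ℂ := poch t n / n.factorial

theorem binomCoeff_succ (t : ℂ) (n : ℕ) :
    binomCoeff t (n + 1) * ((n : ℂ) + 1) = binomCoeff t n * (t + n) := by
  have h1 : (n.factorial : ℂ) ≠ 0 := Nat.cast_ne_zero.2 n.factorial_ne_zero
  have h2 : (n : ℂ) + 1 ≠ 0 := Nat.cast_add_one_ne_zero n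
  rw [binomCoeff, binomCoeff, poch_succ, Nat.factorial_succ]
  push_cast
  field_simp

/-- Inverse of Euler's limit formula for `Γ`. It says that `binomCoeff t n` behaves like `n^(t-1) /
Γ(t)`. -/
theorem tendsto_binomCoeff {t : ℂ} (ht : t ∈ gammaDomain) :
    Tendsto (fun n : ℕ => binomCoeff t n * (t + n) / (n : ℂ) ^ t) atTop
      (𝓝 (Complex.Gamma t)⁻¹) := by
  refine ((Complex.GammaSeq_tendsto_Gamma t).inv₀ (Complex.Gamma_ne_zero ht)).congr fun n => ?_
  rw [Complex.GammaSeq, ← poch_eq_prod, poch_succ, binomCoeff, inv_div, div_mul_eq_mul_div,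
    div_div, mul_comm ((n : ℂ) ^ t)]

theorem tendsto_natCast_cpow_zero {t : ℝ} (ht : t < 0) :
    Tendsto (fun n : ℕ => (n : ℂ) ^ (t : ℂ)) atTop (𝓝 0) := by
  rw [tendsto_zero_iff_norm_tendsto_zero]
  have h1 := (tendsto_rpow_neg_atTop (neg_pos.2 ht)).comp tendsto_natCast_atTop_atTop
  rw [neg_neg] at h1
  refine h1.congr' ?_
  filter_upwards [eventually_gt_atTop 0] with n hn
  rw [Complex.norm_natCast_cpow_of_pos hn]
  rfl

theorem summable_norm_binomCoeff_div {t : ℝ} (ht : t < 0) (htD : (t : ℂ) ∈ gammaDomain) :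
    Summable fun n => ‖binomCoeff t n‖ / ((n : ℝ) + 1) := by
  have h1 : Tendsto (fun n : ℕ => ‖binomCoeff t n * ((n : ℂ) + t)‖) atTop (𝓝 0) := by
    have h2 := ((tendsto_binomCoeff htD).mul (tendsto_natCast_cpow_zero ht)).norm
    rw [mul_zero, norm_zero] at h2
    refine h2.congr' ?_
    filter_upwards [eventually_gt_atTop 0] with n hn
    have : (n : ℂ) ^ (t : ℂ) ≠ 0 := by
      rw [Ne, Complex.cpow_eq_zero_iff]
      exact fun h => hn.ne' (Nat.cast_eq_zero.1 h.1)
    rw [div_mul_cancel₀ _ this, add_comm (n : ℂ)]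
  obtain ⟨M, hM⟩ := h1.bddAbove_range
  obtain ⟨δ, hδ, C, hC, h⟩ := exists_norm_natCast_add_ge htD
  refine ((summable_nat_add_iff 1).2 (Real.summable_one_div_nat_pow.2 one_lt_two) |>.mul_left
    (M / C)).of_nonneg_of_le (fun n => by positivity) fun n => ?_
  have h3 : ‖binomCoeff t n * ((n : ℂ) + t)‖ ≤ M := hM ⟨n, rfl⟩
  have h4 := h t (Metric.mem_ball_self hδ) n
  rw [norm_mul] at h3
  have h5 : ‖binomCoeff t n‖ * (C * ((n : ℝ) + 1)) ≤ M :=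
    (mul_le_mul_of_nonneg_left h4 (norm_nonneg _)).trans h3
  push_cast
  rw [div_mul_div_comm, mul_one, div_le_div_iff₀ (by positivity) (by positivity)]
  nlinarith [n.cast_nonneg (α := ℝ)]

theorem hasSum_binomCoeff {x : ℝ} (hx0 : 0 ≤ x) (hx1 : x < 1) (t : ℂ) :
    HasSum (fun n => binomCoeff t n * (x : ℂ) ^ n) ((1 - (x : ℂ)) ^ (-t)) := by
  have h1 := (Complex.one_div_one_sub_cpow_hasFPowerSeriesOnBall_zero t).hasSum (y := (x : ℂ))
    (by simp [enorm_eq_nnnorm, ← NNReal.coe_lt_coe, abs_of_nonneg hx0, hx1])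
  rw [zero_add, one_div, ← Complex.cpow_neg] at h1
  refine h1.congr_fun fun n => ?_
  have h2 := Ring.factorial_nsmul_multichoose_eq_ascPochhammer t n
  rw [Polynomial.ascPochhammer_smeval_eq_eval, nsmul_eq_mul] at h2
  have h3 : (n.factorial : ℂ) ≠ 0 := Nat.cast_ne_zero.2 n.factorial_ne_zero
  simp only [FormalMultilinearSeries.ofScalars_apply_eq, smul_eq_mul]
  rw [← Ring.multichoose_eq, binomCoeff, poch, ← h2]
  field_simp

/-- Expand `(1-x)^(-t)` in the Beta integral of `x^(a-1) (1-x)^(-t)` and integrate term by term; `t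
< 0` makes the integrals of the norms summable. -/
theorem tsum_binomCoeff_of_pos {t : ℝ} (ht : t < 0) (htD : (t : ℂ) ∈ gammaDomain) {a : ℝ}
    (ha : 0 < a) : ∑' n : ℕ, binomCoeff t n * ((n : ℂ) + a)⁻¹ =
      Complex.Gamma a * Complex.Gamma (1 - t) / Complex.Gamma (a + (1 - t)) := by
  rw [← Complex.betaIntegral_eq_Gamma_mul_div _ _ (by simpa using ha) (by simp; linarith),
    Complex.betaIntegral, intervalIntegral.integral_of_le zero_le_one]
  set μ := MeasureTheory.volume.restrict (Set.Ioc (0 : ℝ) 1) with hμ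
  set F : ℕ → ℝ → ℂ := fun n x => binomCoeff t n * ((x ^ (n + a - 1 : ℝ) : ℝ) : ℂ) with hF
  have hexp : ∀ n : ℕ, -1 < (n : ℝ) + a - 1 := fun n => by linarith [n.cast_nonneg (α := ℝ)]
  have hint : ∀ n : ℕ, MeasureTheory.Integrable (fun x : ℝ => x ^ (n + a - 1 : ℝ)) μ := fun n =>
    (intervalIntegrable_iff_integrableOn_Ioc_of_le zero_le_one).1
      (intervalIntegral.intervalIntegrable_rpow' (hexp n))
  have hval : ∀ n : ℕ, ∫ x, x ^ (n + a - 1 : ℝ) ∂μ = ((n : ℝ) + a)⁻¹ := by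
    intro n
    have h0 : (n : ℝ) + a ≠ 0 := by linarith [n.cast_nonneg (α := ℝ)]
    rw [hμ, ← intervalIntegral.integral_of_le zero_le_one, integral_rpow (.inl (hexp n)),
      sub_add_cancel, Real.one_rpow, Real.zero_rpow h0, sub_zero, one_div]
  have hFi : ∀ n, MeasureTheory.Integrable (F n) μ := fun n => (hint n).ofReal.const_mul _
  have hFv : ∀ n, ∫ x, F n x ∂μ = binomCoeff t n * ((n : ℂ) + a)⁻¹ := by
    intro n
    have h1 : ∫ x, ((x ^ (n + a - 1 : ℝ) : ℝ) : ℂ) ∂μ = ((∫ x, x ^ (n + a - 1 : ℝ) ∂μ : ℝ) : ℂ) :=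
      integral_ofReal
    rw [hF, MeasureTheory.integral_const_mul, h1, hval]
    push_cast
    rfl
  have hFn : ∀ n, ∫ x, ‖F n x‖ ∂μ = ‖binomCoeff t n‖ * ((n : ℝ) + a)⁻¹ := by
    intro n
    rw [← hval, ← MeasureTheory.integral_const_mul]
    refine MeasureTheory.setIntegral_congr_fun measurableSet_Ioc fun x hx => ?_
    simp only [hF, norm_mul, Complex.norm_real, Real.norm_eq_abs]
    rw [abs_of_nonneg (Real.rpow_nonneg hx.1.le _)]
  have haD : (a : ℂ) ∈ gammaDomain := mem_gammaDomain_of_re_pos (by simpa using ha)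
  have hs : Summable fun n => ∫ x, ‖F n x‖ ∂μ := by
    have h1 := (summable_mul_inv_pow 0 (u := binomCoeff t)
      (by simpa using summable_norm_binomCoeff_div ht htD) haD).norm
    refine h1.congr fun n => ?_
    have h2 : ‖(n : ℂ) + a‖ = (n : ℝ) + a := by
      rw [show (n : ℂ) + a = ((n + a : ℝ) : ℂ) by push_cast; rfl, Complex.norm_real,
        Real.norm_of_nonneg (by positivity)]
    rw [hFn, norm_mul, zero_add, pow_one, norm_inv, h2]
  have h1 := MeasureTheory.hasSum_integral_of_summable_integral_norm hFi hs
  simp only [hFv] at h1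
  rw [h1.tsum_eq]
  refine MeasureTheory.integral_congr_ae ?_
  have hne : ∀ᵐ x ∂μ, x ≠ 1 := by
    refine MeasureTheory.ae_restrict_of_ae ?_
    exact MeasureTheory.Measure.ae_ne MeasureTheory.volume 1
  filter_upwards [MeasureTheory.ae_restrict_mem measurableSet_Ioc, hne] with x hx hx1
  have hx1' : x < 1 := lt_of_le_of_ne hx.2 hx1
  have h2 := (hasSum_binomCoeff hx.1.le hx1' t).mul_left ((x : ℂ) ^ ((a : ℂ) - 1))
  rw [show (1 : ℂ) - t - 1 = -t by ring, ← h2.tsum_eq]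
  refine tsum_congr fun n => ?_
  have h3 : ((x ^ (n + a - 1 : ℝ) : ℝ) : ℂ) = (x : ℂ) ^ ((a : ℂ) - 1) * (x : ℂ) ^ n := by
    rw [show (n : ℝ) + a - 1 = a - 1 + n by ring, Real.rpow_add hx.1, Real.rpow_natCast]
    push_cast
    rw [Complex.ofReal_cpow hx.1.le]
    push_cast
    rfl
  simp only [hF]
  rw [h3]
  ring

/-- The Beta function in the first argument, as a meromorphic function. -/
noncomputable def betaFun (c a : ℂ) : ℂ :=
  Complex.Gamma a * Complex.Gamma c / Complex.Gamma (a + c)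

/-- As `1/Γ` is entire, poles of `Γ(a+c)` do no harm. -/
theorem differentiableOn_betaFun (c : ℂ) : DifferentiableOn ℂ (betaFun c) gammaDomain := by
  have h1 : DifferentiableOn ℂ (fun a => (Complex.Gamma (a + c))⁻¹) gammaDomain :=
    (Complex.differentiable_one_div_Gamma.comp
      (differentiable_id.add_const c)).differentiableOn
  simpa only [betaFun, div_eq_mul_inv] using! (differentiableOn_Gamma.mul_const _).mul h1

theorem tsum_binomCoeff {t : ℝ} (ht : t < 0) (htD : (t : ℂ) ∈ gammaDomain) {a : ℂ}
    (ha : a ∈ gammaDomain) : betaFun (1 - t) a =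
      poleSeries (binomCoeff t) a + ∑' n : ℕ, binomCoeff t n * ((n : ℂ) + 1)⁻¹ := by
  have hs := summable_norm_binomCoeff_div ht htD
  have hu : Summable fun n => ‖binomCoeff t n‖ / ((n : ℝ) + 1) ^ 2 :=
    summable_norm_div_pow_mono (p := 1) (by norm_num) (by simpa using hs)
  refine eqOn_gammaDomain_of_eqOn_pos (f := betaFun (1 - t)) (g := fun a =>
    poleSeries (binomCoeff t) a + ∑' n : ℕ, binomCoeff t n * ((n : ℂ) + 1)⁻¹)
    (differentiableOn_betaFun _) ((differentiableOn_poleSeries hu).add_const _) (fun x hx => ?_) ha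
  have hD : (x : ℂ) ∈ gammaDomain := mem_gammaDomain_of_re_pos (by simpa using hx)
  rw [betaFun, ← tsum_binomCoeff_of_pos ht htD hx, poleSeries, ← (summable_poleSeries hu hD).tsum_add]
  · refine tsum_congr fun n => ?_
    ring
  · simpa using summable_mul_inv_pow 0 (u := binomCoeff t) (by simpa using hs) one_mem_gammaDomain

theorem hasSum_binomCoeff_mul_inv_pow {t : ℝ} (ht : t < 0) (htD : (t : ℂ) ∈ gammaDomain) {a : ℂ}
    (ha : a ∈ gammaDomain) (p : ℕ) :
    HasSum (fun n : ℕ => binomCoeff t n * ((n : ℂ) + a)⁻¹ ^ (p + 1))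
      ((-1) ^ p * (p.factorial : ℂ)⁻¹ * iteratedDeriv p (betaFun (1 - t)) a) := by
  have hs := summable_norm_binomCoeff_div ht htD
  have hu : Summable fun n => ‖binomCoeff t n‖ / ((n : ℝ) + 1) ^ 2 :=
    summable_norm_div_pow_mono (p := 1) (by norm_num) (by simpa using hs)
  have hsum := summable_mul_inv_pow p (u := binomCoeff t)
    (summable_norm_div_pow_mono (p := 1) (by omega) (by simpa using hs)) ha
  convert hsum.hasSum using 1
  cases p with
  | zero =>
    rw [iteratedDeriv_zero, tsum_binomCoeff ht htD ha, poleSeries,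
      ← (summable_poleSeries hu ha).tsum_add]
    · simp
    · simpa using summable_mul_inv_pow 0 (u := binomCoeff t) (by simpa using hs) one_mem_gammaDomain
  | succ m =>
    rw [iteratedDeriv_of_eqOn_poleSeries hu (fun a ha => tsum_binomCoeff ht htD ha) m ha]
    have h1 : ((m + 1).factorial : ℂ) ≠ 0 := Nat.cast_ne_zero.2 (m + 1).factorial_ne_zero
    have h2 : ((-1 : ℂ) ^ (m + 1)) * (-1) ^ (m + 1) = 1 := by rw [← mul_pow]; simp
    rw [show ∀ x y z w : ℂ, x * y⁻¹ * (z * y * w) = (x * z) * (y⁻¹ * y) * w by intros; ring, h2,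
      inv_mul_cancel₀ h1]
    ring

/-! ### Polynomial multiples of the binomial coefficients -/

/-- The basis `(t+n)_i` replaces the powers of `n` because `(t)_n (t+n)_i = (t)_(n+i)` can be summed
in closed form. The recurrence is `n (t+n)_i = (t+n)_(i+1) - (t+i) (t+n)_i`. -/
theorem natCast_pow_mem_span_poch (t : ℂ) (j : ℕ) : (fun n : ℕ => (n : ℂ) ^ j) ∈
    Submodule.span ℂ (Set.range fun (i n : ℕ) => poch (t + n) i) := by
  set W := Submodule.span ℂ (Set.range fun (i n : ℕ) => poch (t + n) i) with hW
  have hmul : ∀ f ∈ W, ((fun n : ℕ => (n : ℂ)) * f) ∈ W := by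
    suffices W ≤ W.comap (LinearMap.mulLeft ℂ fun n : ℕ => (n : ℂ)) from fun f hf => this hf
    refine Submodule.span_le.2 ?_
    rintro _ ⟨i, rfl⟩
    have e : ((fun n : ℕ => (n : ℂ)) * fun n : ℕ => poch (t + n) i) =
        (fun n : ℕ => poch (t + n) (i + 1)) - (t + i) • fun n : ℕ => poch (t + n) i := by
      ext n
      simp only [Pi.mul_apply, Pi.sub_apply, Pi.smul_apply, smul_eq_mul, poch_succ]
      ring
    change ((fun n : ℕ => (n : ℂ)) * fun n : ℕ => poch (t + n) i) ∈ W
    rw [e]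
    exact sub_mem (Submodule.subset_span ⟨i + 1, rfl⟩)
      (W.smul_mem _ (Submodule.subset_span ⟨i, rfl⟩))
  induction j with
  | zero => exact Submodule.subset_span ⟨0, by ext n; simp [poch_zero]⟩
  | succ j ih =>
    convert hmul _ ih using 1
    ext n
    simp [pow_succ']

theorem exists_polynomial_poch (t : ℂ) (i : ℕ) :
    ∃ Q : Polynomial ℂ, ∀ n : ℕ, poch (t + n) i = Q.eval (n : ℂ) :=
  ⟨(ascPochhammer ℂ i).comp (Polynomial.C t + Polynomial.X), fun n => by simp [poch]⟩

theorem sum_binomCoeff_mul_poch {t : ℂ} (ht : t ∈ gammaDomain) (i X : ℕ) :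
    ∑ n ∈ Finset.range X, binomCoeff t n * poch (t + n) i =
      binomCoeff t X * (X * (t + i)⁻¹ * poch (t + X) i) := by
  have h0 : t + i ≠ 0 := by rw [add_comm]; exact natCast_add_ne_zero ht i
  induction X with
  | zero => simp
  | succ X ih =>
    rw [Finset.sum_range_succ, ih]
    have h1 := binomCoeff_succ t X
    have h2 : (t + X) * poch (t + X + 1) i = poch (t + X) i * (t + X + i) := by
      have := poch_add (t + X) 1 i
      rw [add_comm 1 i, poch_succ, poch_succ, poch_zero, Nat.cast_one, Nat.cast_zero] at this
      linear_combination -this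
    push_cast
    rw [← add_assoc]
    have h3 : (t + i)⁻¹ * (t + i) = 1 := inv_mul_cancel₀ h0
    linear_combination (-(t + i)⁻¹ * poch (t + X + 1) i) * h1 - binomCoeff t X * (t + i)⁻¹ * h2 -
      binomCoeff t X * poch (t + X) i * h3

theorem exists_polynomial_sum_binomCoeff {K : IntermediateField ℚ ℂ} {t : ℂ} (ht : t ∈ gammaDomain)
    {f : ℕ → ℂ} (hf : f ∈ polySeqs K) : ∃ Q : Polynomial ℂ, ∀ X : ℕ,
      ∑ n ∈ Finset.range X, binomCoeff t n * f n = binomCoeff t X * Q.eval (X : ℂ) := by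
  have hf' : f ∈ Submodule.span ℂ (Set.range fun (i n : ℕ) => poch (t + n) i) := by
    induction hf using Submodule.span_induction with
    | mem x h => obtain ⟨j, rfl⟩ := h; exact natCast_pow_mem_span_poch t j
    | zero => exact zero_mem _
    | add x y _ _ hx hy => exact add_mem hx hy
    | smul c x _ hx => exact Submodule.smul_mem _ (c : ℂ) hx
  clear hf
  induction hf' using Submodule.span_induction with
  | mem x h =>
    obtain ⟨i, rfl⟩ := h
    obtain ⟨Q, hQ⟩ := exists_polynomial_poch t i
    refine ⟨Polynomial.X * Polynomial.C (t + i)⁻¹ * Q, fun X => ?_⟩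
    rw [sum_binomCoeff_mul_poch ht, hQ, Polynomial.eval_mul, Polynomial.eval_mul, Polynomial.eval_X,
      Polynomial.eval_C]
  | zero => exact ⟨0, by simp⟩
  | add x y _ _ hx hy =>
    obtain ⟨P, hP⟩ := hx
    obtain ⟨Q, hQ⟩ := hy
    exact ⟨P + Q, fun X => by simp [mul_add, Finset.sum_add_distrib, hP, hQ]⟩
  | smul c x _ hx =>
    obtain ⟨P, hP⟩ := hx
    refine ⟨Polynomial.C c * P, fun X => ?_⟩
    rw [Polynomial.eval_mul, Polynomial.eval_C, mul_left_comm, ← hP, Finset.mul_sum]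
    exact Finset.sum_congr rfl fun n _ => by simp [mul_left_comm]

theorem tendsto_eval_div_pow (Q : Polynomial ℂ) :
    Tendsto (fun n : ℕ => Q.eval (n : ℂ) / (n : ℂ) ^ Q.natDegree) atTop (𝓝 Q.leadingCoeff) := by
  have h1 : Tendsto (fun n : ℕ => Q.reverse.eval ((n : ℂ)⁻¹)) atTop (𝓝 (Q.reverse.eval 0)) :=
    (Q.reverse.continuous.tendsto 0).comp (by simpa using tendsto_inv_natCast_add 0)
  rw [← Polynomial.coeff_zero_eq_eval_zero, Polynomial.coeff_zero_reverse] at h1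
  refine h1.congr' ?_
  filter_upwards [eventually_gt_atTop 0] with n hn
  have h0 : (n : ℂ) ≠ 0 := Nat.cast_ne_zero.2 hn.ne'
  let _ := invertibleOfNonzero h0
  have h2 := Polynomial.eval₂_reverse_mul_pow (RingHom.id ℂ) (n : ℂ) Q
  rw [invOf_eq_inv, Polynomial.eval₂_id, Polynomial.eval₂_id] at h2
  rw [← h2, mul_div_cancel_right₀ _ (pow_ne_zero _ h0)]

theorem eq_zero_of_tendsto_natCast_rpow {e c : ℝ} (hc : c ≠ 0)
    (h : Tendsto (fun n : ℕ => (n : ℝ) ^ e) atTop (𝓝 c)) : e = 0 := by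
  rcases lt_trichotomy e 0 with he | he | he
  · have h1 := (tendsto_rpow_neg_atTop (neg_pos.2 he)).comp (tendsto_natCast_atTop_atTop (R := ℝ))
    rw [neg_neg] at h1
    exact absurd (tendsto_nhds_unique h h1) hc
  · exact he
  · have h1 := (tendsto_rpow_atTop he).comp (tendsto_natCast_atTop_atTop (R := ℝ))
    exact absurd h (not_tendsto_nhds_of_tendsto_atTop h1 _)

/-- If a polynomial multiple of the binomial coefficients converges, then it tends to zero. -/
theorem eq_zero_of_tendsto_binomCoeff_mul {t : ℝ} (ht : t < 0) (htD : (t : ℂ) ∈ gammaDomain)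
    {Q : Polynomial ℂ} {S : ℂ}
    (h : Tendsto (fun n : ℕ => binomCoeff t n * Q.eval (n : ℂ)) atTop (𝓝 S)) : S = 0 := by
  by_contra hS
  have hQ : Q ≠ 0 := by
    rintro rfl
    exact hS (tendsto_nhds_unique h (by simp))
  have hl : Q.leadingCoeff ≠ 0 := Polynomial.leadingCoeff_ne_zero.2 hQ
  have hΓ : (Complex.Gamma t)⁻¹ ≠ 0 := inv_ne_zero (Complex.Gamma_ne_zero htD)
  have h1 : Tendsto (fun n : ℕ => ((n : ℂ) + t)⁻¹ * n) atTop (𝓝 1) := by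
    have h2 := ((tendsto_inv_natCast_add t).const_mul (-(t : ℂ))).const_add 1
    simp only [mul_zero, add_zero] at h2
    refine h2.congr fun n => ?_
    have := natCast_add_ne_zero htD n
    field_simp
    ring
  -- The three known asymptotics are divided out of the sequence so that exactly the norm of `n^(t +
  -- deg Q - 1)` remains. A nonzero limit forces this exponent to vanish, making `t` equal to 1 or a
  -- nonpositive integer.
  have h3 := ((h.div (tendsto_binomCoeff htD) hΓ).div (tendsto_eval_div_pow Q) hl).norm
  have h4 := h3.div (h1.norm) (by simp)
  have hne : ‖S / (Complex.Gamma t)⁻¹ / Q.leadingCoeff‖ / ‖(1 : ℂ)‖ ≠ 0 := by simp [hS, Complex.Gamma_ne_zero htD, hl]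
  have hev : ∀ᶠ n : ℕ in atTop, Q.eval (n : ℂ) ≠ 0 := by
    have h5 := tendsto_eval_div_pow Q
    filter_upwards [h5.eventually_ne hl] with n hn h0
    exact hn (by simp [h0])
  have key : Tendsto (fun n : ℕ => (n : ℝ) ^ (t + Q.natDegree - 1)) atTop
      (𝓝 (‖S / (Complex.Gamma t)⁻¹ / Q.leadingCoeff‖ / ‖(1 : ℂ)‖)) := by
    refine h4.congr' ?_
    filter_upwards [eventually_gt_atTop 0, hev] with n hn hQn
    have hn0 : (0 : ℝ) < n := Nat.cast_pos.2 hn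
    have hn0' : (n : ℂ) ≠ 0 := Nat.cast_ne_zero.2 hn.ne'
    have hb : binomCoeff t n ≠ 0 :=
      div_ne_zero (poch_ne_zero htD n) (Nat.cast_ne_zero.2 n.factorial_ne_zero)
    have ha := natCast_add_ne_zero htD n
    have e1 : ‖(n : ℂ) ^ (t : ℂ)‖ = (n : ℝ) ^ t := by
      rw [Complex.norm_natCast_cpow_of_pos hn, Complex.ofReal_re]
    rw [Real.rpow_sub hn0, Real.rpow_add hn0, Real.rpow_natCast, Real.rpow_one, ← e1]
    simp only [Pi.div_apply, add_comm (t : ℂ)]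
    have hp : (n : ℂ) ^ (t : ℂ) ≠ 0 := by
      rw [Ne, Complex.cpow_eq_zero_iff]
      exact fun h => hn0' h.1
    have e2 : (n : ℝ) = ‖(n : ℂ)‖ := by simp
    rw [e2, ← norm_pow, ← norm_mul, ← norm_div, ← norm_div]
    congr 1
    field_simp
  have h6 := eq_zero_of_tendsto_natCast_rpow hne key
  have h7 : t = 1 - Q.natDegree := by linarith
  rcases Nat.eq_zero_or_pos Q.natDegree with hd | hd
  · rw [hd] at h7
    norm_num at h7
    linarith
  · refine htD (Q.natDegree - 1) ?_
    rw [h7, Nat.cast_sub hd]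
    push_cast
    ring

/-! ### Derivatives of the Beta function -/

theorem hasDerivAt_Gamma_digamma {a : ℂ} (ha : a ∈ gammaDomain) :
    HasDerivAt Complex.Gamma (Complex.Gamma a * polygamma 0 a) a := by
  refine (Complex.differentiableAt_Gamma a ha).hasDerivAt.congr_deriv ?_
  rw [polygamma_zero, Complex.digamma_def, logDeriv_apply,
    mul_div_cancel₀ _ (Complex.Gamma_ne_zero ha)]

theorem hasDerivAt_betaFun {a c : ℂ} (ha : a ∈ gammaDomain) (hac : a + c ∈ gammaDomain) :
    HasDerivAt (betaFun c) (betaFun c a * (polygamma 0 a - polygamma 0 (a + c))) a := by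
  have h0 := Complex.Gamma_ne_zero hac
  refine (((hasDerivAt_Gamma_digamma ha).mul_const (Complex.Gamma c)).div
    ((hasDerivAt_Gamma_digamma hac).comp_add_const a c) h0).congr_deriv ?_
  rw [betaFun]
  field_simp

section
variable (K : IntermediateField ℚ ℂ)

/-- The algebra of functions generated by the polygamma functions at `a` and at `a + c`. -/
noncomputable def polygammaFunctions (c : ℂ) : Subalgebra K (ℂ → ℂ) :=
  Algebra.adjoin K {f | ∃ m, f = polygamma m ∨ f = fun a => polygamma m (a + c)}

variable {K}

/-- The generators are permuted upwards by differentiation, so by Leibniz the algebra is closed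
under it. -/
theorem exists_hasDerivAt_polygammaFunctions {c : ℂ} {f : ℂ → ℂ} (hf : f ∈ polygammaFunctions K c) :
    ∃ g ∈ polygammaFunctions K c, ∀ a ∈ gammaDomain, a + c ∈ gammaDomain →
      HasDerivAt f (g a) a := by
  induction hf using Algebra.adjoin_induction with
  | mem f hf =>
    obtain ⟨m, rfl | rfl⟩ := hf
    · exact ⟨_, Algebra.subset_adjoin ⟨m + 1, .inl rfl⟩, fun a ha _ => hasDerivAt_polygamma ha m⟩
    · exact ⟨_, Algebra.subset_adjoin ⟨m + 1, .inr rfl⟩, fun a _ hac =>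
        (hasDerivAt_polygamma hac m).comp_add_const a c⟩
  | algebraMap r => exact ⟨0, zero_mem _, fun a _ _ => hasDerivAt_const a (r : ℂ)⟩
  | add f g _ _ hf hg =>
    obtain ⟨f', hf', h1⟩ := hf
    obtain ⟨g', hg', h2⟩ := hg
    exact ⟨f' + g', add_mem hf' hg', fun a ha hac => (h1 a ha hac).add (h2 a ha hac)⟩
  | mul f g hfm hgm hf hg =>
    obtain ⟨f', hf', h1⟩ := hf
    obtain ⟨g', hg', h2⟩ := hg
    exact ⟨f' * g + f * g', add_mem (mul_mem hf' hgm) (mul_mem hfm hg'),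
      fun a ha hac => (h1 a ha hac).mul (h2 a ha hac)⟩

/-- The logarithmic derivative of the Beta function is `ψ(a) - ψ(a+c)`, so each derivative replaces
the cofactor `f` by `(ψ(a) - ψ(a+c)) f + f'`. -/
theorem exists_iteratedDeriv_betaFun (c : ℂ) (m : ℕ) :
    ∃ f ∈ polygammaFunctions K c, ∀ a ∈ gammaDomain, a + c ∈ gammaDomain →
      iteratedDeriv m (betaFun c) a = betaFun c a * f a := by
  induction m with
  | zero => exact ⟨1, one_mem _, fun a _ _ => by simp⟩
  | succ m ih =>
    obtain ⟨f, hf, h⟩ := ih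
    obtain ⟨g, hg, h'⟩ := exists_hasDerivAt_polygammaFunctions hf
    have h1 : (polygamma 0 : ℂ → ℂ) ∈ polygammaFunctions K c :=
      Algebra.subset_adjoin ⟨0, .inl rfl⟩
    have h2 : (fun a => polygamma 0 (a + c)) ∈ polygammaFunctions K c :=
      Algebra.subset_adjoin ⟨0, .inr rfl⟩
    refine ⟨_, add_mem (mul_mem (sub_mem h1 h2) hf) hg, fun a ha hac => ?_⟩
    have hev : iteratedDeriv m (betaFun c) =ᶠ[𝓝 a] fun z => betaFun c z * f z := by
      have hac' : (fun z => z + c) ⁻¹' gammaDomain ∈ 𝓝 a :=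
        (continuous_add_const c).continuousAt.preimage_mem_nhds (isOpen_gammaDomain.mem_nhds hac)
      filter_upwards [isOpen_gammaDomain.mem_nhds ha, hac'] with z hz hzc using h z hz hzc
    rw [iteratedDeriv_succ, (((hasDerivAt_betaFun ha hac).mul (h' a ha hac)).congr_of_eventuallyEq
      hev).deriv]
    simp only [Pi.add_apply, Pi.mul_apply, Pi.sub_apply]
    ring

/-! ### Polygamma values -/

variable {G : AddSubgroup ℝ}

theorem mem_gammaDomain_of_mem_regularArgs {x : ℝ} (hx : x ∈ regularArgs G) :
    (x : ℂ) ∈ gammaDomain := fun n h => hx.2 n (by exact_mod_cast h)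

theorem polygamma_mem_polygammaAlgebra {x : ℝ} (hx : x ∈ regularArgs G) (m : ℕ) :
    polygamma m x ∈ polygammaAlgebra K G :=
  Algebra.subset_adjoin ⟨m, x, hx, rfl⟩

theorem apply_mem_polygammaAlgebra {x y : ℝ} (hx : x ∈ regularArgs G) (hxy : x + y ∈ regularArgs G)
    {f : ℂ → ℂ} (hf : f ∈ polygammaFunctions K y) : f x ∈ polygammaAlgebra K G := by
  induction hf using Algebra.adjoin_induction with
  | mem f hf =>
    obtain ⟨m, rfl | rfl⟩ := hf
    · exact polygamma_mem_polygammaAlgebra hx m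
    · simpa using polygamma_mem_polygammaAlgebra (K := K) hxy m
  | algebraMap r => exact (polygammaAlgebra K G).algebraMap_mem r
  | add f g _ _ hf hg => exact add_mem hf hg
  | mul f g _ _ hf hg => exact mul_mem hf hg

variable (K G)

/-- The complex numbers expressible via polygamma functions, as a vector space over `K`. -/
noncomputable def polygammaSpan : Submodule K ℂ :=
  (Submodule.span (polygammaAlgebra K G)
    {v : ℂ | ∃ x ∈ regularArgs G, ∃ y ∈ regularArgs G, x + y ∈ regularArgs G ∧
      v = Complex.Gamma (x : ℂ) * Complex.Gamma (y : ℂ) /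
        Complex.Gamma ((x + y : ℝ) : ℂ)}).restrictScalars K

variable {K G}

theorem mul_betaFun_mem_polygammaSpan {x y : ℝ} (hx : x ∈ regularArgs G) (hy : y ∈ regularArgs G)
    (hxy : x + y ∈ regularArgs G) {P : ℂ} (hP : P ∈ polygammaAlgebra K G) :
    P * betaFun y x ∈ polygammaSpan K G := by
  refine Submodule.smul_mem _ (⟨P, hP⟩ : polygammaAlgebra K G)
    (Submodule.subset_span ⟨x, hx, y, hy, hxy, ?_⟩)
  rw [betaFun]
  push_cast
  rfl

theorem mem_regularArgs_of_pos {x : ℝ} (hx : x ∈ G) (h : 0 < x) : x ∈ regularArgs G :=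
  ⟨hx, fun n hn => by linarith [n.cast_nonneg (α := ℝ)]⟩

/-- The Beta factor at `x = y = 1` is 1. -/
theorem polygammaAlgebra_le_polygammaSpan (h1 : (1 : ℝ) ∈ G) {P : ℂ}
    (hP : P ∈ polygammaAlgebra K G) : P ∈ polygammaSpan K G := by
  have hr : (1 : ℝ) ∈ regularArgs G := mem_regularArgs_of_pos h1 one_pos
  have h := mul_betaFun_mem_polygammaSpan hr hr
    (mem_regularArgs_of_pos (add_mem h1 h1) (by norm_num)) hP
  have h2 : Complex.Gamma (1 + 1) = 1 := by
    rw [Complex.Gamma_add_one 1 one_ne_zero, Complex.Gamma_one, one_mul]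
  simpa [betaFun, h2] using h

theorem iteratedDeriv_betaFun_mem_polygammaSpan {x y : ℝ} (hx : x ∈ regularArgs G)
    (hy : y ∈ regularArgs G) (hxy : x + y ∈ regularArgs G) (m : ℕ) :
    iteratedDeriv m (betaFun y) x ∈ polygammaSpan K G := by
  obtain ⟨f, hf, h⟩ := exists_iteratedDeriv_betaFun (K := K) (y : ℂ) m
  have hxyD := mem_gammaDomain_of_mem_regularArgs hxy
  push_cast at hxyD
  rw [h x (mem_gammaDomain_of_mem_regularArgs hx) hxyD, mul_comm]
  exact mul_betaFun_mem_polygammaSpan hx hy hxy (apply_mem_polygammaAlgebra hx hxy hf)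

theorem sign_div_factorial_mem (p : ℕ) : (-1 : ℂ) ^ p * (p.factorial : ℂ)⁻¹ ∈ K :=
  mul_mem (pow_mem (neg_mem (one_mem K)) p) (inv_mem (natCast_mem K _))

/-- The partial sums of the harmonic series. -/
noncomputable def harmonicSum (X : ℕ) : ℂ := ∑ n ∈ Finset.range X, ((n : ℂ) + 1)⁻¹

theorem tendsto_norm_harmonicSum : Tendsto (fun X => ‖harmonicSum X‖) atTop atTop := by
  refine Real.tendsto_sum_range_one_div_nat_succ_atTop.congr fun X => ?_
  have : harmonicSum X = ((∑ n ∈ Finset.range X, 1 / ((n : ℝ) + 1) : ℝ) : ℂ) := by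
    rw [harmonicSum]
    push_cast
    simp only [one_div]
  rw [this, Complex.norm_real, Real.norm_of_nonneg]
  exact Finset.sum_nonneg fun n _ => by positivity

/-- A simple pole minus one harmonic sum converges to `ψ(1) - ψ(x)`; higher poles converge to
rational multiples of polygamma values. -/
theorem regTendsto_polygamma_pole (h1 : (1 : ℝ) ∈ G) {x : ℝ} (hx : x ∈ regularArgs G) (p : ℕ) :
    RegTendsto (polygammaSpan K G) harmonicSum
      fun X => ∑ n ∈ Finset.range X, (1 : ℂ) ^ n * ((n : ℂ) + x)⁻¹ ^ (p + 1) := by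
  have hD := mem_gammaDomain_of_mem_regularArgs hx
  simp only [one_pow, one_mul]
  cases p with
  | zero =>
    have hr : (1 : ℝ) ∈ regularArgs G := mem_regularArgs_of_pos h1 one_pos
    refine ⟨1, polygamma 0 1 - polygamma 0 x, ?_, (tendsto_sum_inv_sub hD).congr fun X => ?_⟩
    · refine polygammaAlgebra_le_polygammaSpan h1 (sub_mem ?_ (polygamma_mem_polygammaAlgebra hx 0))
      simpa using polygamma_mem_polygammaAlgebra (K := K) hr 0
    · rw [Finset.sum_sub_distrib, harmonicSum]
      simp
  | succ m =>
    have hs : Summable fun n : ℕ => ((n : ℂ) + x)⁻¹ ^ (m + 2) := by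
      refine (summable_mul_inv_pow (u := fun _ => -1) (m + 1)
        (summable_norm_div_pow_mono (by omega) summable_one_div_succ_sq) hD).neg.congr fun n => ?_
      rw [neg_one_mul, neg_neg]
    have h2 : ∑' n : ℕ, ((n : ℂ) + x)⁻¹ ^ (m + 2) =
        -((-1) ^ (m + 1) * ((m + 1).factorial : ℂ)⁻¹) * polygamma (m + 1) x := by
      have h3 : ((m + 1).factorial : ℂ) ≠ 0 := Nat.cast_ne_zero.2 (m + 1).factorial_ne_zero
      have h4 : ((-1 : ℂ) ^ m) * (-1) ^ m = 1 := by rw [← mul_pow]; simp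
      rw [polygamma_succ_eq hD, pow_succ]
      generalize ∑' n : ℕ, ((n : ℂ) + x)⁻¹ ^ (m + 2) = σ
      field_simp
      linear_combination (-σ) * h4
    refine .of_tendsto ?_ hs.hasSum.tendsto_sum_nat
    rw [h2]
    exact (polygammaSpan K G).smul_mem (⟨_, neg_mem (sign_div_factorial_mem (m + 1))⟩ : K)
      (polygammaAlgebra_le_polygammaSpan h1 (polygamma_mem_polygammaAlgebra hx (m + 1)))

/-! ### Series with real first parameter -/

theorem exists_tendsto_of_mem_poleSeqs {T : Set ℂ} {E : Submodule K ℂ} {u : ℕ → ℂ}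
    (hT : ∀ α ∈ T, ∀ p : ℕ, ∃ S ∈ E,
      Tendsto (fun X => ∑ n ∈ Finset.range X, u n * ((n : ℂ) + α)⁻¹ ^ (p + 1)) atTop (𝓝 S))
    {f : ℕ → ℂ} (hf : f ∈ poleSeqs K T) :
    ∃ S ∈ E, Tendsto (fun X => ∑ n ∈ Finset.range X, u n * f n) atTop (𝓝 S) := by
  induction hf using Submodule.span_induction with
  | mem x h => obtain ⟨α, hα, p, rfl⟩ := h; exact hT α hα p
  | zero => exact ⟨0, zero_mem _, by simp⟩
  | add x y _ _ hx hy =>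
    obtain ⟨S, hS, h⟩ := hx
    obtain ⟨S', hS', h'⟩ := hy
    exact ⟨S + S', add_mem hS hS', by simpa [mul_add, Finset.sum_add_distrib] using h.add h'⟩
  | smul c x _ hx =>
    obtain ⟨S, hS, h⟩ := hx
    refine ⟨c • S, E.smul_mem c hS, (h.const_mul (c : ℂ)).congr fun X => ?_⟩
    rw [Finset.mul_sum]
    refine Finset.sum_congr rfl fun n _ => ?_
    change _ = u n * (c * x n)
    ring

/-- The pole part converges by itself, so the polynomial part does too; its partial sums have the
form `binomCoeff t X * Q(X)`, hence limit zero. -/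
theorem mem_of_tendsto_sum_binomCoeff {t : ℝ} (ht : t < 0) (htD : (t : ℂ) ∈ gammaDomain)
    {T : Set ℂ} {E : Submodule K ℂ}
    (hT : ∀ α ∈ T, ∀ p : ℕ, ∃ S ∈ E, Tendsto
      (fun X => ∑ n ∈ Finset.range X, binomCoeff t n * ((n : ℂ) + α)⁻¹ ^ (p + 1)) atTop (𝓝 S))
    {f : ℕ → ℂ} (hf : f ∈ polySeqs K ⊔ poleSeqs K T) {S : ℂ}
    (h : Tendsto (fun X => ∑ n ∈ Finset.range X, binomCoeff t n * f n) atTop (𝓝 S)) : S ∈ E := by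
  obtain ⟨g, hg, k, hk, rfl⟩ := Submodule.mem_sup.1 hf
  obtain ⟨U, hU, hUk⟩ := exists_tendsto_of_mem_poleSeqs hT hk
  obtain ⟨Q, hQ⟩ := exists_polynomial_sum_binomCoeff htD hg
  have h1 : Tendsto (fun X : ℕ => binomCoeff t X * Q.eval (X : ℂ)) atTop (𝓝 (S - U)) := by
    refine (h.sub hUk).congr fun X => ?_
    rw [← hQ, ← Finset.sum_sub_distrib]
    exact Finset.sum_congr rfl fun n _ => by simp [mul_add]
  rwa [sub_eq_zero.1 (eq_zero_of_tendsto_binomCoeff_mul ht htD h1)]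

theorem polygammaExpressible_of_nonint {t : ℝ} (ht : ∀ m : ℤ, t ≠ m) (htK : (t : ℂ) ∈ K)
    (h1G : (1 : ℝ) ∈ G) (htG : t ∈ G) {r s : ℕ} {A : Fin r → ℝ} {B : Fin s → ℂ} {M : Fin r → ℕ}
    {N : Fin s → ℕ} (hAG : ∀ i, A i ∈ G) (hAK : ∀ i, (A i : ℂ) ∈ K) (hBK : ∀ j, B j ∈ K) {S : ℂ}
    (h : HypConvergesTo ((t : ℂ) :: (List.ofFn (fun i => (A i : ℂ)) ++ List.ofFn B))
      (List.ofFn (fun i => (A i : ℂ) + (M i : ℂ)) ++ List.ofFn (fun j => B j - (N j : ℂ))) 1 S) :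
    PolygammaExpressible K G S := by
  have hnat : ∀ n : ℕ, (n : ℝ) ∈ G := fun n => by simpa using G.nsmul_mem h1G n
  -- All pole parameters `x` are at least `-L`, and shifting `t` by `2 * L` gives `t' ≤ -L - 1`.
  -- Then `x + (1 - t') ≥ 2`, so the denominator `Γ(x + (1 - t'))` of the Beta value is regular.
  obtain ⟨L, hL⟩ := exists_nat_ge (1 + |t| + ∑ i, |A i|)
  have hsum : 0 ≤ ∑ i, |A i| := Finset.sum_nonneg fun i _ => abs_nonneg _
  have hAL : ∀ i, -(L : ℝ) ≤ A i := fun i => by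
    have h1 := Finset.single_le_sum (f := fun i => |A i|) (fun i _ => abs_nonneg _)
      (Finset.mem_univ i)
    linarith [neg_abs_le (A i), abs_nonneg t]
  set m := 2 * L with hm
  set t' : ℝ := t - m with ht'
  have ht'L : t' ≤ -L - 1 := by
    rw [ht', hm]
    push_cast
    linarith [le_abs_self t]
  have ht'0 : t' < 0 := by linarith [L.cast_nonneg (α := ℝ)]
  have ht'int : ∀ n : ℤ, t' ≠ n := fun n hn => ht (n + m) (by push_cast; linarith)
  have ht'D : (t' : ℂ) ∈ gammaDomain := fun n hn => ht'int (-n) (by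
    have : t' = -(n : ℝ) := by exact_mod_cast hn
    simpa using this)
  have ht'c : (t' : ℂ) = t - m := by rw [ht']; push_cast; rfl
  have hy : 1 - t' ∈ regularArgs G :=
    mem_regularArgs_of_pos (sub_mem h1G (sub_mem htG (hnat m))) (by linarith)
  set T : Set ℂ := {α | ∃ x ∈ regularArgs G, -(L : ℝ) ≤ x ∧ α = x ∧ α ∈ K} with hT
  have hTK : ∀ α ∈ T, α ∈ K ∧ ∀ n : ℕ, α ≠ -(n : ℂ) := by
    rintro _ ⟨x, hx, -, rfl, hxK⟩
    exact ⟨hxK, mem_gammaDomain_of_mem_regularArgs hx⟩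
  have hTE : ∀ α ∈ T, ∀ p : ℕ, ∃ S ∈ polygammaSpan K G, Tendsto
      (fun X => ∑ n ∈ Finset.range X, binomCoeff t' n * ((n : ℂ) + α)⁻¹ ^ (p + 1)) atTop
      (𝓝 S) := by
    rintro _ ⟨x, hx, hxL, rfl, -⟩ p
    refine ⟨_, ?_, (hasSum_binomCoeff_mul_inv_pow ht'0 ht'D
      (mem_gammaDomain_of_mem_regularArgs hx) p).tendsto_sum_nat⟩
    refine (polygammaSpan K G).smul_mem (⟨_, sign_div_factorial_mem p⟩ : K) ?_
    simpa using iteratedDeriv_betaFun_mem_polygammaSpan (K := K) hx hy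
      (mem_regularArgs_of_pos (add_mem hx.1 hy.1) (by linarith)) p
  have hAT : ∀ i, ∀ l : ℕ, (A i : ℂ) + l ∈ T := by
    intro i l
    have hreg := ne_neg_natCast_add (ne_neg_natCast_of_hypConvergesTo h i) l
    refine ⟨A i + l, ⟨add_mem (hAG i) (hnat l), fun n hn => hreg n ?_⟩, ?_, by push_cast; rfl,
      add_mem (hAK i) (natCast_mem K l)⟩
    · exact_mod_cast congrArg (fun x : ℝ => (x : ℂ)) hn
    · linarith [hAL i, l.cast_nonneg (α := ℝ)]
  have hBN : ∀ j, ∀ n : ℕ, B j - N j ≠ -(n : ℂ) := fun j =>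
    h.defined _ (List.mem_append_right _ (List.mem_ofFn.2 ⟨j, rfl⟩))
  have ht'D' : ∀ n : ℕ, (t : ℂ) - m ≠ -(n : ℂ) := by rw [← ht'c]; exact ht'D
  refine mem_of_tendsto_sum_binomCoeff ht'0 ht'D hTE (mem_of_mem_seqMultipliers (mul_mem
    (poch_div_sub_mem_seqMultipliers hTK htK (m := m) ht'D')
    (prod_poch_div_mem_seqMultipliers (M := M) hTK hAT hBK hBN))) (h.tendsto.congr fun X => ?_)
  refine Finset.sum_congr rfl fun n _ => ?_
  have h0 := poch_ne_zero ht'D' n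
  rw [hypTerm_cons_ofFn, binomCoeff, ht'c]
  simp only [Pi.mul_apply, one_pow]
  field_simp

theorem polygammaExpressible_of_natCast {k : ℕ}
    (h1G : (1 : ℝ) ∈ G) {r s : ℕ} {A : Fin r → ℝ} {B : Fin s → ℂ} {M : Fin r → ℕ}
    {N : Fin s → ℕ} (hAG : ∀ i, A i ∈ G) (hAK : ∀ i, (A i : ℂ) ∈ K) (hBK : ∀ j, B j ∈ K) {S : ℂ}
    (h : HypConvergesTo ((k : ℂ) :: (List.ofFn (fun i => (A i : ℂ)) ++ List.ofFn B))
      (List.ofFn (fun i => (A i : ℂ) + (M i : ℂ)) ++ List.ofFn (fun j => B j - (N j : ℂ))) 1 S) :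
    PolygammaExpressible K G S := by
  have hnat : ∀ n : ℕ, (n : ℝ) ∈ G := fun n => by simpa using G.nsmul_mem h1G n
  refine mem_of_hypConvergesTo (E := polygammaSpan K G) (T := {α | ∃ x ∈ regularArgs G, α = x ∧ α ∈ K})
    (one_pow 2) tendsto_norm_harmonicSum ?_ ?_ (fun i l => ?_) hBK h
  · rintro _ ⟨x, hx, rfl, hxK⟩
    exact ⟨hxK, mem_gammaDomain_of_mem_regularArgs hx⟩
  · rintro _ ⟨x, hx, rfl, -⟩ p
    exact regTendsto_polygamma_pole h1G hx p
  · have hreg := ne_neg_natCast_add (ne_neg_natCast_of_hypConvergesTo h i) l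
    refine ⟨A i + l, ⟨add_mem (hAG i) (hnat l), fun n hn => hreg n ?_⟩, by push_cast; rfl,
      add_mem (hAK i) (natCast_mem K l)⟩
    exact_mod_cast congrArg (fun x : ℝ => (x : ℂ)) hn

end

theorem proposition1 {r s : ℕ} (k : ℕ) (t : ℝ) (M : Fin r → ℕ) (N : Fin s → ℕ) (B : Fin s → ℂ)
    (A A₁ : Fin r → ℂ) (A₂ : Fin r → ℝ)
    (hA : ∀ i, ∃ p : ℤ, A i = (p : ℂ) / 2) (hA₁ : ∀ i, ∃ p : ℤ, A₁ i = (p : ℂ) / 4) :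
    (∀ S : ℂ,
      HypConvergesTo ((k : ℂ) :: (List.ofFn A ++ List.ofFn B))
        (List.ofFn (fun i => A i + (M i : ℂ)) ++ List.ofFn (fun j => B j - (N j : ℂ))) (-1) S →
      LevelFourExpressible (IntermediateField.adjoin ℚ (Set.range B)) S) ∧
    (∀ S : ℂ,
      HypConvergesTo ((k : ℂ) :: (List.ofFn A₁ ++ List.ofFn B))
        (List.ofFn (fun i => A₁ i + (M i : ℂ)) ++ List.ofFn (fun j => B j - (N j : ℂ))) 1 S →
      LevelFourExpressible (IntermediateField.adjoin ℚ (Set.range B)) S) ∧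
    (∀ S : ℂ,
      HypConvergesTo ((t : ℂ) :: (List.ofFn (fun i => (A₂ i : ℂ)) ++ List.ofFn B))
        (List.ofFn (fun i => (A₂ i : ℂ) + (M i : ℂ)) ++ List.ofFn (fun j => B j - (N j : ℂ))) 1 S →
      PolygammaExpressible
        (IntermediateField.adjoin ℚ
          ({(t : ℂ)} ∪ Set.range (fun i => (A₂ i : ℂ)) ∪ Set.range B))
        (AddSubgroup.closure ({1, t} ∪ Set.range A₂)) S) := by
  refine ⟨fun S h => ?_, fun S h => ?_, fun S h => ?_⟩
  · exact levelFourExpressible_of_hypConvergesTo (d := 2) (by norm_num) two_ne_zero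
      (fun α hα hreg p => regTendsto_half_pole (by exact_mod_cast hα) hreg p)
      (by exact_mod_cast hA) (fun j => IntermediateField.subset_adjoin ℚ _ (Set.mem_range_self j)) h
  · exact levelFourExpressible_of_hypConvergesTo (d := 4) (by norm_num) four_ne_zero
      (fun α hα hreg p => regTendsto_quarter_pole (by exact_mod_cast hα) hreg p)
      (by exact_mod_cast hA₁) (fun j => IntermediateField.subset_adjoin ℚ _ (Set.mem_range_self j)) h
  · have h1G : (1 : ℝ) ∈ AddSubgroup.closure ({1, t} ∪ Set.range A₂) :=
      AddSubgroup.subset_closure (by simp)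
    have htG : t ∈ AddSubgroup.closure ({1, t} ∪ Set.range A₂) :=
      AddSubgroup.subset_closure (by simp)
    have hAG : ∀ i, A₂ i ∈ AddSubgroup.closure ({1, t} ∪ Set.range A₂) := fun i =>
      AddSubgroup.subset_closure (.inr ⟨i, rfl⟩)
    set K := IntermediateField.adjoin ℚ
      ({(t : ℂ)} ∪ Set.range (fun i => (A₂ i : ℂ)) ∪ Set.range B)
    have htK : (t : ℂ) ∈ K := IntermediateField.subset_adjoin _ _ (by simp)
    have hAK : ∀ i, (A₂ i : ℂ) ∈ K := fun i => IntermediateField.subset_adjoin _ _ (by simp)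
    have hBK : ∀ j, B j ∈ K := fun j => IntermediateField.subset_adjoin _ _ (by simp)
    by_cases ht : ∃ m : ℤ, t = m
    · obtain ⟨m, rfl⟩ := ht
      -- A negative integer as first parameter would make the series terminate.
      have hm : 0 ≤ m := by
        by_contra hm
        refine h.nonterminating _ List.mem_cons_self (-m).toNat ?_
        have : (((-m).toNat : ℤ) : ℂ) = ((-m : ℤ) : ℂ) := by rw [Int.toNat_of_nonneg (by omega)]
        rw [Int.cast_natCast] at this
        rw [this]
        push_cast
        ring
      lift m to ℕ using hm
      exact polygammaExpressible_of_natCast h1G hAG hAK hBK (by exact_mod_cast h)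
    · exact polygammaExpressible_of_nonint (not_exists.1 ht) htK h1G htG hAG hAK hBK h
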